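/- Let $\mathcal T_n$ be the random binary search tree with $n$ nodes, i.e. the tree obtained by inserting $n$ distinct keys, drawn in uniformly random order, one after another into an initially empty binary search tree. Let $\Lambda_n$ be the random recursive tree with $n$ nodes: start with a root labelled $1$ and, for $i=2,\dots,n$, attach a new node $i$ to one of the nodes $1,\dots,i-1$ chosen uniformly at random, independently of the earlier choices. A fringe subtree of a rooted tree consists of a node and all its descendants, and its size is its number of nodes. For integers $1\le k<n$ let $X_{n,k}$ and $\hat X_{n,k}$ be the number of fringe subtrees of size $k$ in $\mathcal T_n$ and in $\Lambda_n$, respectively, and let $\mu_{n,k}:=\mathbb E(X_{n,k})$ and $\hat\mu_{n,k}:=\mathbb E(\hat X_{n,k})$. Let $\mathcal L(X)$ denote the distribution of $X$, let $\mathrm{Po}(\mu)$ denote the Poisson distribution with mean $\mu$, and let $d_{TV}(P,Q):=\sup_A|P(A)-Q(A)|$ be the total variation distance, with the supremum over all measurable sets $A$. Then, for all integers $1\le k<n$, $$\mu_{n,k}=\frac{2(n+1)}{(k+1)(k+2)},\qquad \hat\mu_{n,k}=\frac{n}{k(k+1)},$$ and there is an absolute constant $C$ such that, for all integers $1\le k<n$,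 $$d_{TV}\bigl(\mathcal L(X_{n,k}),\mathrm{Po}(\mu_{n,k})\bigr)=\frac12\sum_{l\ge0}\Bigl|\mathbb P(X_{n,k}=l)-e^{-\mu_{n,k}}\frac{\mu_{n,k}^l}{l!}\Bigr|\le\frac Ck,$$ $$d_{TV}\bigl(\mathcal L(\hat X_{n,k}),\mathrm{Po}(\hat\mu_{n,k})\bigr)=\frac12\sum_{l\ge0}\Bigl|\mathbb P(\hat X_{n,k}=l)-e^{-\hat\mu_{n,k}}\frac{\hat\mu_{n,k}^l}{l!}\Bigr|\le\frac Ck.$$ Consequently, if $k<n$ and $k\to\infty$ (and hence $n\to\infty$) along any sequence of pairs $(n,k)$, then $d_{TV}(\mathcal L(X_{n,k}),\mathrm{Po}(\mu_{n,k}))\to0$ and $d_{TV}(\mathcal L(\hat X_{n,k}),\mathrm{Po}(\hat\mu_{n,k}))\to0$. -/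

import Mathlib

namespace FringeTrees

open MeasureTheory ProbabilityTheory

/-- The total variation distance `sup_A |μ(A) - ν(A)|` over all measurable sets `A`. -/
noncomputable def dTV {α : Type*} [MeasurableSpace α] (μ ν : Measure α) : ℝ :=
  ⨆ A : {A : Set α // MeasurableSet A}, |μ.real A.1 - ν.real A.1|

/-! ### The random binary search tree -/

/-- Insert a key into a binary search tree: starting at the root, the new key moves to the left
child if it is smaller than the key at the current node and to the right child otherwise, until it
reaches an empty place. -/
def bstInsert {α : Type*} [LinearOrder α] (x : α) : BinaryTree α → BinaryTree α
  | .nil => .node x .nil .nil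
  | .node y l r => if x < y then .node y (bstInsert x l) r else .node y l (bstInsert x r)

/-- The binary search tree obtained by inserting the keys of a list one by one, in the order of the
list, into the empty tree. -/
def bstOfList {α : Type*} [LinearOrder α] (keys : List α) : BinaryTree α :=
  keys.foldl (fun t x => bstInsert x t) .nil

/-- The random binary search tree with `n` nodes: the `n` keys are drawn in uniformly random
order (the key drawn at step `i` is `σ i`). -/
noncomputable def randomBST (n : ℕ) : PMF (BinaryTree (Fin n)) :=
  (PMF.uniformOfFintype (Equiv.Perm (Fin n))).map fun σ => bstOfList (List.ofFn fun i => σ i)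

/-- The number of nodes `u` of a binary tree such that the fringe subtree rooted at `u`
(`u` and all its descendants) has exactly `k` nodes. -/
def bstFringeCount {α : Type*} (k : ℕ) : BinaryTree α → ℕ
  | .nil => 0
  | .node a l r =>
      (if (BinaryTree.node a l r).numNodes = k then 1 else 0)
        + bstFringeCount k l + bstFringeCount k r

/-- The law of `X_{n,k}`, the number of fringe subtrees of size `k` in the random binary search
tree with `n` nodes. -/
noncomputable def bstLaw (n k : ℕ) : Measure ℕ :=
  ((randomBST n).map (bstFringeCount k)).toMeasure

/-- `μ_{n,k}`, the expectation of `X_{n,k}`. -/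
noncomputable def bstMean (n k : ℕ) : ℝ := ∫ x, (x : ℝ) ∂(bstLaw n k)

/-! ### The random recursive tree -/

/-- A recursive tree on the nodes `0, 1, …, n - 1` with root `0`, given by the choices of the
parents: node `i + 1` is attached to the node `c i`, which is one of `0, …, i`. -/
abbrev RecursiveTree (n : ℕ) : Type := (i : Fin (n - 1)) → Fin ((i : ℕ) + 1)

/-- `u` is the parent of `v` in the recursive tree `c`. -/
def RecursiveTree.IsParent {n : ℕ} (c : RecursiveTree n) (u v : Fin n) : Prop :=
  ∃ i : Fin (n - 1), (v : ℕ) = (i : ℕ) + 1 ∧ (u : ℕ) = (c i : ℕ)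

/-- The nodes of the fringe subtree rooted at `u`: the node `u` and all its descendants. -/
def RecursiveTree.fringe {n : ℕ} (c : RecursiveTree n) (u : Fin n) : Set (Fin n) :=
  {v | Relation.ReflTransGen c.IsParent u v}

/-- The number of nodes `u` of a recursive tree whose fringe subtree has exactly `k` nodes. -/
noncomputable def rrtFringeCount {n : ℕ} (k : ℕ) (c : RecursiveTree n) : ℕ :=
  {u : Fin n | (c.fringe u).ncard = k}.ncard

/-- The random recursive tree with `n` nodes: the parent of each new node is chosen uniformly at
random among the previous nodes, independently of the earlier choices. -/
noncomputable def randomRecursiveTree (n : ℕ) : Measure (RecursiveTree n) :=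
  Measure.pi fun i : Fin (n - 1) => (PMF.uniformOfFintype (Fin ((i : ℕ) + 1))).toMeasure

/-- The law of `\hat X_{n,k}`, the number of fringe subtrees of size `k` in the random recursive
tree with `n` nodes. -/
noncomputable def rrtLaw (n k : ℕ) : Measure ℕ :=
  (randomRecursiveTree n).map (rrtFringeCount k)

/-- `\hat μ_{n,k}`, the expectation of `\hat X_{n,k}`. -/
noncomputable def rrtMean (n k : ℕ) : ℝ := ∫ x, (x : ℝ) ∂(rrtLaw n k)

end FringeTrees

namespace FringeTrees

open scoped BigOperators

/-! ### The Stein equation for the Poisson distribution -/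

/-! Both counts become sums of locally dependent indicators of a uniformly random permutation, and
the Stein-Chen method does the rest.

Binary search tree: if the key `x` arrives at time `t x`, then `k` consecutive keys form a fringe
subtree exactly when all of them arrive after the keys adjacent to the block. The count is the
number of such windows (`bstFringeCount_ofFn`).

Recursive tree: write a tree with nodes `0, …, N` as the word in which each new label is inserted
directly after its parent. This is a bijection with permutations of the nonzero labels
(`exists_equiv_recursiveTree`), and descendants of `u` form the maximal block that starts at `u` and
otherwise has only larger labels. Fringe subtrees of size `k` are again windows
(`Encodes.rrtFringeCount_eq`).

A window is an event about where a permutation has its minimum, or two smallest values, on an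
interval. Shuffling the values inside the interval computes its probability and shows it independent
of everything determined by the values elsewhere (`expect_isMinAt_mul`). Summing probabilities gives
the means. Windows that are too close exclude each other; the few remaining adjacent pairs have
joint probability `O(k⁻³)` away from the ends.

Stein's equation, with solution increments at most `1 / lam`, bounds the error by sums of `p i * p
j` and of joint probabilities over neighbours, divided by the mean (`abs_expect_sub_poisson_le`).
There are about `k` neighbours of probability `O(k⁻²)` each, so everything is `O(1/k)`; end windows
have probability of order `1/k`, but there are at most two of them. -/

/-- The point probabilities of the Poisson distribution. -/
noncomputable def poissonWeight (lam : ℝ) (j : ℕ) : ℝ :=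
  Real.exp (-lam) * lam ^ j / (Nat.factorial j : ℝ)

lemma poissonWeight_pos {lam : ℝ} (h : 0 < lam) (j : ℕ) : 0 < poissonWeight lam j := by
  unfold poissonWeight; positivity

lemma poissonWeight_succ (lam : ℝ) (j : ℕ) :
    ((j : ℝ) + 1) * poissonWeight lam (j + 1) = lam * poissonWeight lam j := by
  unfold poissonWeight
  rw [Nat.factorial_succ]
  have : (Nat.factorial j : ℝ) ≠ 0 := by positivity
  push_cast
  field_simp
  ring

lemma hasSum_poissonWeight {lam : ℝ} (h : 0 ≤ lam) : HasSum (poissonWeight lam) 1 := by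
  have := ProbabilityTheory.hasSum_one_poissonMeasure ⟨lam, h⟩
  exact this

/-- The solution of the Stein equation for a set `A`. -/
noncomputable def steinSolution (lam : ℝ) (A : Set ℕ) (j : ℕ) : ℝ :=
  (∑ i ∈ Finset.range (j + 1), A.indicator (poissonWeight lam) i
    - (∑' i, A.indicator (poissonWeight lam) i) * ∑ i ∈ Finset.range (j + 1), poissonWeight lam i)
    / (lam * poissonWeight lam j)

/-- The index is shifted by one from the usual convention: `steinSolution lam A j` is the classical
solution at `j + 1`. At `j = 0` the truncated `j - 1` is harmless because of the factor `j`. -/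
lemma steinSolution_equation {lam : ℝ} (h : 0 < lam) (A : Set ℕ) (j : ℕ) :
    lam * steinSolution lam A j - j * steinSolution lam A (j - 1) =
      A.indicator 1 j - ∑' i, A.indicator (poissonWeight lam) i := by
  have hind : ∀ i, A.indicator (poissonWeight lam) i = A.indicator 1 i * poissonWeight lam i := by
    intro i; by_cases hi : i ∈ A <;> simp [hi]
  have hl := h.ne'
  cases j with
  | zero =>
    have hw := (poissonWeight_pos h 0).ne'
    simp only [steinSolution, zero_add, Finset.sum_range_one, hind 0]
    field_simp
    simp
  | succ m =>
    have hw := (poissonWeight_pos h m).ne'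
    have hw' := (poissonWeight_pos h (m + 1)).ne'
    have hm : ((m : ℝ) + 1) ≠ 0 := by positivity
    simp only [steinSolution, Nat.add_sub_cancel]
    rw [Finset.sum_range_succ _ (m + 1), Finset.sum_range_succ _ (m + 1), hind (m + 1),
      ← poissonWeight_succ lam m]
    push_cast
    field_simp
    ring

lemma steinSolution_compl {lam : ℝ} (h : 0 < lam) (A : Set ℕ) (j : ℕ) :
    steinSolution lam Aᶜ j = -steinSolution lam A j := by
  have hs := hasSum_poissonWeight h.le
  have e : ∀ i, Aᶜ.indicator (poissonWeight lam) i =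
      poissonWeight lam i - A.indicator (poissonWeight lam) i := by
    intro i; by_cases hi : i ∈ A <;> simp [hi]
  unfold steinSolution
  simp only [e, Finset.sum_sub_distrib]
  rw [(hs.summable).tsum_sub (hs.summable.indicator A), hs.tsum_eq]
  ring

/-- Termwise, `lam * poissonWeight lam i = (i + 1) * poissonWeight lam (i + 1)` with `i ≤ m`. With
the tail estimate below, this fixes the signs in the increment bound of the Stein solution. -/
lemma poissonWeight_sum_growth {lam : ℝ} (h : 0 < lam) (m : ℕ) :
    lam * ∑ i ∈ Finset.range (m + 1), poissonWeight lam i ≤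
      ((m : ℝ) + 1) * ∑ i ∈ Finset.range (m + 2), poissonWeight lam i := by
  rw [Finset.sum_range_succ' _ (m + 1), mul_add, Finset.mul_sum, Finset.mul_sum]
  have h0 : 0 ≤ ((m : ℝ) + 1) * poissonWeight lam 0 := by
    have := poissonWeight_pos h 0; positivity
  have : ∑ i ∈ Finset.range (m + 1), lam * poissonWeight lam i ≤
      ∑ i ∈ Finset.range (m + 1), ((m : ℝ) + 1) * poissonWeight lam (i + 1) := by
    refine Finset.sum_le_sum fun i hi => ?_
    rw [← poissonWeight_succ]
    have : (i : ℝ) ≤ m := by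
      have := Finset.mem_range.1 hi
      exact_mod_cast Nat.lt_succ_iff.1 this
    have hp := poissonWeight_pos h (i + 1)
    gcongr
  linarith

lemma poissonWeight_tail_decay {lam : ℝ} (h : 0 < lam) (m : ℕ) :
    ((m : ℝ) + 1) * ∑' i, poissonWeight lam (i + (m + 2)) ≤
      lam * ∑' i, poissonWeight lam (i + (m + 1)) := by
  have hs := (hasSum_poissonWeight h.le).summable
  rw [← tsum_mul_left, ← tsum_mul_left]
  refine Summable.tsum_le_tsum (fun i => ?_)
    (((summable_nat_add_iff (m + 2)).2 hs).mul_left _)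
    (((summable_nat_add_iff (m + 1)).2 hs).mul_left _)
  have := poissonWeight_succ lam (i + (m + 1))
  rw [← this]
  have hp := poissonWeight_pos h (i + (m + 1) + 1)
  have e : i + (m + 2) = i + (m + 1) + 1 := by ring
  rw [e]
  gcongr
  have : (0 : ℝ) ≤ i := by positivity
  linarith

/-- The increment is linear in the masses that `A` has below, at and above `m + 1`. The masses below
and above enter with nonpositive coefficients, so only the point `m + 1` can push it up, by at most
`1 / lam`. Taking complements then gives the lower bound. -/
lemma steinSolution_succ_sub_le {lam : ℝ} (h : 0 < lam) (A : Set ℕ) (m : ℕ) :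
    steinSolution lam A (m + 1) - steinSolution lam A m ≤ 1 / lam := by
  have hs := (hasSum_poissonWeight h.le)
  have hsA := hs.summable.indicator A
  have hnn : ∀ i, 0 ≤ A.indicator (poissonWeight lam) i :=
    Set.indicator_nonneg fun i _ => (poissonWeight_pos h i).le
  set P := ∑ i ∈ Finset.range (m + 1), A.indicator (poissonWeight lam) i with hP
  set S := ∑ i ∈ Finset.range (m + 1), poissonWeight lam i with hS
  set Q := ∑' i, A.indicator (poissonWeight lam) (i + (m + 2)) with hQ
  set T := ∑' i, poissonWeight lam (i + (m + 2)) with hT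
  set a := A.indicator (poissonWeight lam) (m + 1) with ha
  set w := poissonWeight lam (m + 1) with hw
  set v := poissonWeight lam m with hv
  have hwp : 0 < w := poissonWeight_pos h _
  have hvp : 0 < v := poissonWeight_pos h _
  have hP0 : 0 ≤ P := Finset.sum_nonneg fun i _ => hnn i
  have hS0 : 0 ≤ S := Finset.sum_nonneg fun i _ => (poissonWeight_pos h i).le
  have hT0 : 0 ≤ T := tsum_nonneg fun i => (poissonWeight_pos h _).le
  have hQ0 : 0 ≤ Q := tsum_nonneg fun i => hnn _
  have ha0 : 0 ≤ a := hnn _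
  have haw : a ≤ w := Set.indicator_le_self' (fun _ _ => (poissonWeight_pos h _).le) _
  have hST : S + w + T = 1 := by
    rw [hS, hw, ← Finset.sum_range_succ, hT, hs.summable.sum_add_tsum_nat_add, hs.tsum_eq]
  have hPQ : ∑' i, A.indicator (poissonWeight lam) i = P + a + Q := by
    rw [hP, ha, ← Finset.sum_range_succ, hQ, hsA.sum_add_tsum_nat_add]
  have hgrow : lam * S ≤ ((m : ℝ) + 1) * (S + w) := by
    have := poissonWeight_sum_growth h m
    rwa [Finset.sum_range_succ _ (m + 1)] at this
  have hdec : ((m : ℝ) + 1) * T ≤ lam * (w + T) := by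
    have := poissonWeight_tail_decay h m
    have e : ∑' i, poissonWeight lam (i + (m + 1)) = w + T := by
      rw [((summable_nat_add_iff (m + 1)).2 hs.summable).tsum_eq_zero_add]
      simp only [zero_add, hw, hT]
      congr 2
      ext i; congr 1; ring
    rwa [e] at this
  have hrec : ((m : ℝ) + 1) * w = lam * v := poissonWeight_succ lam m
  have hm : (0 : ℝ) < (m : ℝ) + 1 := by positivity
  -- Both quotients are put over one denominator by `(m + 1) * w = lam * v`, and `S + w + T = 1`
  -- removes the products of masses of `A` with the full sum.
  have hdiff : steinSolution lam A (m + 1) - steinSolution lam A m =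
      (((m : ℝ) + 1) * ((P + a) * T - Q * (S + w)) - lam * (P * (w + T) - (a + Q) * S))
        / (lam * (((m : ℝ) + 1) * w)) := by
    unfold steinSolution
    rw [Finset.sum_range_succ _ (m + 1), Finset.sum_range_succ _ (m + 1), hPQ]
    simp only [← hP, ← hS, ← ha, ← hw, ← hv]
    rw [← hrec, show T = 1 - S - w by linarith]
    have := h.ne'
    field_simp
    ring
  rw [hdiff, div_le_div_iff₀ (by positivity) h]
  have h1 : 0 ≤ P * (lam * (w + T) - ((m : ℝ) + 1) * T) :=
    mul_nonneg hP0 (by linarith)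
  have h2 : 0 ≤ Q * (((m : ℝ) + 1) * (S + w) - lam * S) :=
    mul_nonneg hQ0 (by linarith)
  have h3 : a * (((m : ℝ) + 1) * T + lam * S) ≤ w * ((m : ℝ) + 1) := by
    have h4 : ((m : ℝ) + 1) * T + lam * S ≤ (m : ℝ) + 1 := by
      calc _ ≤ ((m : ℝ) + 1) * T + ((m : ℝ) + 1) * (S + w) := by linarith
        _ = ((m : ℝ) + 1) * (S + w + T) := by ring
        _ = _ := by rw [hST, mul_one]
    exact mul_le_mul haw h4 (by positivity) hwp.le
  rw [one_mul, mul_comm lam (((m : ℝ) + 1) * w)]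
  refine mul_le_mul_of_nonneg_right ?_ h.le
  linarith

lemma abs_steinSolution_succ_sub_le {lam : ℝ} (h : 0 < lam) (A : Set ℕ) (m : ℕ) :
    |steinSolution lam A (m + 1) - steinSolution lam A m| ≤ 1 / lam := by
  have h1 := steinSolution_succ_sub_le h A m
  have h2 := steinSolution_succ_sub_le h Aᶜ m
  rw [steinSolution_compl h, steinSolution_compl h] at h2
  rw [abs_le]
  constructor <;> linarith

lemma abs_steinSolution_sub_le {lam : ℝ} (h : 0 < lam) (A : Set ℕ) {a b : ℕ} (hab : a ≤ b) :
    |steinSolution lam A b - steinSolution lam A a| ≤ ((b : ℝ) - a) / lam := by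
  induction b, hab using Nat.le_induction with
  | base => simp
  | succ b _ ih =>
    have := abs_steinSolution_succ_sub_le h A b
    calc |steinSolution lam A (b + 1) - steinSolution lam A a|
        ≤ |steinSolution lam A (b + 1) - steinSolution lam A b|
          + |steinSolution lam A b - steinSolution lam A a| := abs_sub_le _ _ _
      _ ≤ 1 / lam + ((b : ℝ) - a) / lam := add_le_add this ih
      _ = _ := by push_cast; ring

/-! ### Poisson approximation under local dependence -/

section LocalDependence

open scoped Classical in
/-- The number of events of a family that occur. -/
noncomputable def occurrences {Ω ι : Type*} (J : Finset ι) (I : ι → Ω → Prop) (ω : Ω) : ℕ :=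
  (J.filter fun i => I i ω).card

open scoped Classical in
/-- The real valued indicator of an event. -/
noncomputable def ind (p : Prop) : ℝ := if p then 1 else 0

lemma ind_nonneg (p : Prop) : 0 ≤ ind p := by unfold ind; split_ifs <;> norm_num

lemma ind_of {p : Prop} (h : p) : ind p = 1 := if_pos h

lemma ind_of_not {p : Prop} (h : ¬p) : ind p = 0 := if_neg h

lemma ind_and (p q : Prop) : ind (p ∧ q) = ind p * ind q := by
  by_cases hp : p <;> by_cases hq : q <;> simp [ind, hp, hq]

lemma ind_mono {p q : Prop} (h : p → q) : ind p ≤ ind q := by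
  by_cases hp : p
  · rw [ind_of hp, ind_of (h hp)]
  · rw [ind_of_not hp]; exact ind_nonneg q

lemma occurrences_cast {Ω ι : Type*} (J : Finset ι) (I : ι → Ω → Prop) (ω : Ω) :
    (occurrences J I ω : ℝ) = ∑ i ∈ J, ind (I i ω) := by
  classical
  simp [occurrences, ind]

lemma occurrences_split {Ω ι : Type*} [DecidableEq ι] (J N : Finset ι) (I : ι → Ω → Prop) (ω : Ω) :
    (occurrences J I ω : ℝ) = occurrences (J \ N) I ω + ∑ j ∈ J ∩ N, ind (I j ω) := by
  rw [occurrences_cast, occurrences_cast, add_comm, Finset.sum_inter_add_sum_sdiff]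

/-- The Stein-Chen bound for a sum of locally dependent indicators. -/
theorem abs_expect_sub_poisson_le {Ω ι : Type*} [Fintype Ω] [Nonempty Ω] [DecidableEq ι]
    (J : Finset ι) (I : ι → Ω → Prop) (N : ι → Finset ι) (p : ι → ℝ) (e : ι → ι → ℝ)
    (hself : ∀ i ∈ J, i ∈ N i)
    (hp : ∀ i ∈ J, 𝔼 ω, ind (I i ω) = p i)
    (he : ∀ i ∈ J, ∀ j ∈ J, j ∈ N i → j ≠ i → 𝔼 ω, ind (I i ω) * ind (I j ω) ≤ e i j)
    (hindep : ∀ i ∈ J, ∀ g : ℕ → ℝ, 𝔼 ω, ind (I i ω) * g (occurrences (J \ N i) I ω) =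
      p i * 𝔼 ω, g (occurrences (J \ N i) I ω))
    (hpos : 0 < ∑ i ∈ J, p i) (A : Set ℕ) :
    |𝔼 ω, ind (occurrences J I ω ∈ A) -
        ∑' l, A.indicator (poissonWeight (∑ i ∈ J, p i)) l| ≤
      (∑ i ∈ J, (p i * ∑ j ∈ J ∩ N i, p j + ∑ j ∈ (J ∩ N i).erase i, e i j)) / ∑ i ∈ J, p i := by
  set lam := ∑ i ∈ J, p i with hlam
  set W := occurrences J I with hW
  set V : ι → Ω → ℕ := fun i => occurrences (J \ N i) I with hV
  set g := steinSolution lam A with hg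
  have hpn : ∀ i ∈ J, 0 ≤ p i := fun i hi => by
    rw [← hp i hi]
    exact Finset.expect_nonneg fun ω _ => ind_nonneg _
  have hVW : ∀ i ω, V i ω ≤ W ω := fun i ω => by
    classical
    exact Finset.card_le_card (Finset.filter_subset_filter _ Finset.sdiff_subset)
  have hstein : ∀ ω, ind (W ω ∈ A) - ∑' l, A.indicator (poissonWeight lam) l =
      ∑ i ∈ J, (p i * g (W ω) - ind (I i ω) * g (W ω - 1)) := by
    intro ω
    have h1 := steinSolution_equation hpos A (W ω)
    have h2 : ind (W ω ∈ A) = A.indicator 1 (W ω) := by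
      by_cases h : W ω ∈ A <;> simp [ind, h]
    rw [h2, ← h1, Finset.sum_sub_distrib, ← Finset.sum_mul, ← Finset.sum_mul, ← hlam, hW,
      occurrences_cast]
  -- Independence of `I i` and `V i` allows `p i * 𝔼 g (V i)` to be subtracted and `𝔼 ind (I i) * g
  -- (V i)` to be added, so that only increments of `g` remain.
  have hmain : 𝔼 ω, ind (W ω ∈ A) - ∑' l, A.indicator (poissonWeight lam) l =
      ∑ i ∈ J, (p i * 𝔼 ω, (g (W ω) - g (V i ω)) +
        𝔼 ω, ind (I i ω) * (g (V i ω) - g (W ω - 1))) := by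
    have h0 : 𝔼 ω, ind (W ω ∈ A) - ∑' l, A.indicator (poissonWeight lam) l =
        𝔼 ω, (ind (W ω ∈ A) - ∑' l, A.indicator (poissonWeight lam) l) := by
      rw [Finset.expect_sub_distrib, Fintype.expect_const]
    rw [h0, Finset.expect_congr rfl fun ω _ => hstein ω, Finset.expect_sum_comm]
    refine Finset.sum_congr rfl fun i hi => ?_
    simp only [mul_sub, Finset.expect_sub_distrib]
    rw [hindep i hi g, ← Finset.mul_expect]
    ring
  rw [hmain, Finset.sum_div]
  refine (Finset.abs_sum_le_sum_abs _ _).trans (Finset.sum_le_sum fun i hi => ?_)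
  rw [add_div]
  refine (abs_add_le _ _).trans (add_le_add ?_ ?_)
  · rw [abs_mul, abs_of_nonneg (hpn i hi), mul_div_assoc]
    refine mul_le_mul_of_nonneg_left ?_ (hpn i hi)
    calc |𝔼 ω, (g (W ω) - g (V i ω))| ≤ 𝔼 ω, |g (W ω) - g (V i ω)| := Finset.abs_expect_le _ _
      _ ≤ 𝔼 ω, (∑ j ∈ J ∩ N i, ind (I j ω)) / lam := by
        refine Finset.expect_le_expect fun ω _ => ?_
        refine (abs_steinSolution_sub_le hpos A (hVW i ω)).trans_eq ?_
        rw [hW, occurrences_split J (N i)]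
        simp only [hV, add_sub_cancel_left]
      _ = _ := by
        rw [← Finset.expect_div, Finset.expect_sum_comm]
        congr 1
        exact Finset.sum_congr rfl fun j hj => hp j (Finset.mem_inter.1 hj).1
  · calc |𝔼 ω, ind (I i ω) * (g (V i ω) - g (W ω - 1))|
        ≤ 𝔼 ω, |ind (I i ω) * (g (V i ω) - g (W ω - 1))| := Finset.abs_expect_le _ _
      _ ≤ 𝔼 ω, (∑ j ∈ (J ∩ N i).erase i, ind (I i ω) * ind (I j ω)) / lam := by
        refine Finset.expect_le_expect fun ω _ => ?_
        rw [abs_mul, abs_of_nonneg (ind_nonneg _), ← Finset.mul_sum, mul_div_assoc]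
        by_cases hI : I i ω
        · rw [ind_of hI, one_mul, one_mul]
          have hsplit := occurrences_split J (N i) I ω
          rw [← Finset.add_sum_erase _ _ (Finset.mem_inter.2 ⟨hi, hself i hi⟩), ind_of hI]
            at hsplit
          have hnn : 0 ≤ ∑ j ∈ (J ∩ N i).erase i, ind (I j ω) :=
            Finset.sum_nonneg fun j _ => ind_nonneg _
          -- On the event `I i`, the index `i` itself is counted by `W` but not by `V i`; hence `W -
          -- 1 - V i` counts only the other neighbours.
          have hlt : V i ω + 1 ≤ W ω := by
            have : (V i ω : ℝ) + 1 ≤ W ω := by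
              rw [hW, hsplit]; simp only [hV]; linarith
            exact_mod_cast this
          rw [abs_sub_comm]
          refine (abs_steinSolution_sub_le hpos A (by omega)).trans_eq ?_
          rw [Nat.cast_sub (by omega), hW, hsplit]
          simp only [hV]
          push_cast
          ring
        · simp [ind_of_not hI]
      _ = (∑ j ∈ (J ∩ N i).erase i, 𝔼 ω, ind (I i ω) * ind (I j ω)) / lam := by
        rw [← Finset.expect_div, Finset.expect_sum_comm]
      _ ≤ _ := by
        refine div_le_div_of_nonneg_right (Finset.sum_le_sum fun j hj => ?_) hpos.le
        rw [Finset.mem_erase, Finset.mem_inter] at hj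
        exact he i hi j hj.2.1 hj.2.2 hj.1

end LocalDependence

/-! ### Poisson approximation for counts of windows -/

/-- The number of the endpoints `0` and `m` that are equal to `i`. -/
noncomputable def endpointCount (m i : ℕ) : ℝ := ind (i = 0) + ind (i = m)

lemma endpointCount_nonneg (m i : ℕ) : 0 ≤ endpointCount m i :=
  add_nonneg (ind_nonneg _) (ind_nonneg _)

lemma sum_ind_le {ι : Type*} [DecidableEq ι] (J S : Finset ι) (q : ι → Prop)
    (h : ∀ i ∈ J, q i → i ∈ S) : ∑ i ∈ J, ind (q i) ≤ S.card := by
  classical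
  simp only [ind, Finset.sum_boole]
  exact_mod_cast Finset.card_le_card fun i hi => h i (Finset.mem_filter.1 hi).1
    (Finset.mem_filter.1 hi).2

lemma sum_endpointCount_le (J : Finset ℕ) (m : ℕ) : ∑ i ∈ J, endpointCount m i ≤ 2 := by
  simp only [endpointCount, Finset.sum_add_distrib]
  have h1 := sum_ind_le J {0} (fun i => i = 0) (by simp)
  have h2 := sum_ind_le J {m} (fun i => i = m) (by simp)
  simp only [Finset.card_singleton, Nat.cast_one] at h1 h2
  linarith

/-- Two windows of length `k` starting at `i` and `j` are disjoint, at distance at most one. -/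
def Adjacent (k i j : ℕ) : Prop := i + k = j ∨ i + k + 1 = j ∨ j + k = i ∨ j + k + 1 = i

lemma adjacent_comm (k i j : ℕ) : Adjacent k i j ↔ Adjacent k j i := by
  unfold Adjacent; tauto

lemma sum_ind_adjacent_le (J : Finset ℕ) (k i : ℕ) : ∑ j ∈ J, ind (Adjacent k i j) ≤ 4 := by
  refine (sum_ind_le J {i + k, i + k + 1, i - k, i - k - 1} _ fun j _ h => ?_).trans ?_
  · simp only [Finset.mem_insert, Finset.mem_singleton]
    unfold Adjacent at h
    omega
  · exact_mod_cast Finset.card_le_four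

/-- The common form of both tree models: probability of order `k⁻²` except for order `1/k` at the
ends, joint occurrence of nearby windows only when adjacent, independence of distant windows. The
constant is `84 = 12 + 72`, from the products of probabilities and from the pairs. -/
theorem abs_expect_sub_poisson_le_of_windows {Ω : Type*} [Fintype Ω] [Nonempty Ω]
    (n k m : ℕ) (hk : 1 ≤ k) (hkn : k < n) (hm : m < n) (I : ℕ → Ω → Prop) (p : ℕ → ℝ)
    (hple : ∀ i ≤ m, p i ≤ 2 / (k : ℝ) ^ 2 + endpointCount m i / k)
    (hpair : ∀ i j, i < j → j ≤ m → j ≤ i + k + 1 → 𝔼 ω, ind (I i ω) * ind (I j ω) ≤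
      ind (Adjacent k i j) *
        (2 / (k : ℝ) ^ 3 + (endpointCount m i + endpointCount m j) / (k : ℝ) ^ 2))
    (hindep : ∀ i ≤ m, ∀ J : Finset ℕ, (∀ j ∈ J, j ≤ m ∧ (i + k + 1 < j ∨ j + k + 1 < i)) →
      ∀ g : ℕ → ℝ, 𝔼 ω, ind (I i ω) * g (occurrences J I ω) =
        p i * 𝔼 ω, g (occurrences J I ω))
    (hsum : (n : ℝ) / (3 * (k : ℝ) ^ 2) ≤ ∑ i ∈ Finset.range (m + 1), p i) (A : Set ℕ) :
    |𝔼 ω, ind (occurrences (Finset.range (m + 1)) I ω ∈ A) -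
        ∑' l, A.indicator (poissonWeight (∑ i ∈ Finset.range (m + 1), p i)) l| ≤ 84 / k := by
  set J := Finset.range (m + 1) with hJ
  have hJm : ∀ {i}, i ∈ J → i ≤ m := fun h => Nat.lt_succ_iff.1 (Finset.mem_range.1 h)
  set lam := ∑ i ∈ J, p i with hlam
  set B := endpointCount m with hB
  have hk' : (1 : ℝ) ≤ k := by exact_mod_cast hk
  have hk0 : (0 : ℝ) < k := by linarith
  have hn0 : (0 : ℝ) < n := by exact_mod_cast (by omega : 0 < n)
  have hkn' : (k : ℝ) ≤ n := by exact_mod_cast hkn.le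
  have hpos : 0 < lam := lt_of_lt_of_le (by positivity) hsum
  set N : ℕ → Finset ℕ := fun i => Finset.Icc (i - (k + 1)) (i + k + 1) with hN
  set e : ℕ → ℕ → ℝ := fun i j =>
    ind (Adjacent k i j) * (2 / (k : ℝ) ^ 3 + (B i + B j) / (k : ℝ) ^ 2) with he
  have henn : ∀ i j, 0 ≤ e i j := fun i j => by
    have h1 := ind_nonneg (Adjacent k i j)
    have h2 := endpointCount_nonneg m i
    have h3 := endpointCount_nonneg m j
    simp only [he, hB]
    positivity
  have hmean : ∀ i ∈ J, 𝔼 ω, ind (I i ω) = p i := by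
    intro i hi
    have := hindep i (hJm hi) ∅ (by simp) (fun _ => 1)
    simpa using this
  have hpn : ∀ i ∈ J, 0 ≤ p i := fun i hi => by
    rw [← hmean i hi]
    exact Finset.expect_nonneg fun ω _ => ind_nonneg _
  refine (abs_expect_sub_poisson_le J I N p e ?_ hmean ?_ ?_ hpos A).trans ?_
  · intro i _
    simp only [hN, Finset.mem_Icc]; omega
  · intro i hi j hj hjN hji
    simp only [hN, Finset.mem_Icc] at hjN
    rcases lt_or_gt_of_ne hji with h | h
    · have := hpair j i h (hJm hi) (by omega)
      simp only [mul_comm (ind (I j _))] at this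
      refine this.trans_eq ?_
      simp only [he]
      rw [show Adjacent k j i = Adjacent k i j from propext (adjacent_comm k j i), add_comm (B i)]
    · exact hpair i j h (hJm hj) (by omega)
  · intro i hi g
    refine hindep i (hJm hi) _ (fun j hj => ?_) g
    simp only [hN, Finset.mem_sdiff, Finset.mem_Icc] at hj
    exact ⟨hJm hj.1, by omega⟩
  · rw [div_le_iff₀ hpos, Finset.sum_add_distrib]
    have hfirst : ∑ i ∈ J, p i * ∑ j ∈ J ∩ N i, p j ≤ 12 / k * lam := by
      rw [hlam, mul_comm, Finset.sum_mul]
      refine Finset.sum_le_sum fun i hi => mul_le_mul_of_nonneg_left ?_ (hpn i hi)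
      -- A neighbourhood has at most `2 * k + 3 ≤ 5 * k` elements, as `k ≥ 1`.
      have hcard : ((J ∩ N i).card : ℝ) ≤ 5 * k := by
        have h1 : (J ∩ N i).card ≤ (N i).card := Finset.card_le_card Finset.inter_subset_right
        rw [Nat.card_Icc] at h1
        exact_mod_cast (by omega : (J ∩ N i).card ≤ 5 * k)
      calc ∑ j ∈ J ∩ N i, p j ≤ ∑ j ∈ J ∩ N i, (2 / (k : ℝ) ^ 2 + B j / k) :=
            Finset.sum_le_sum fun j hj => hple j (hJm (Finset.mem_inter.1 hj).1)
        _ = (J ∩ N i).card * (2 / (k : ℝ) ^ 2) + (∑ j ∈ J ∩ N i, B j) / k := by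
            rw [Finset.sum_add_distrib, Finset.sum_const, nsmul_eq_mul, Finset.sum_div]
        _ ≤ 5 * k * (2 / (k : ℝ) ^ 2) + 2 / k := by
            gcongr
            exact sum_endpointCount_le _ _
        _ = 12 / k := by field_simp; norm_num
    have hsecond : ∑ i ∈ J, ∑ j ∈ (J ∩ N i).erase i, e i j ≤ 72 / k * lam := by
      have hBnn := endpointCount_nonneg m
      have hR : ∀ i, ∑ j ∈ J, ind (Adjacent k i j) ≤ 4 := sum_ind_adjacent_le J k
      have hRB : ∑ i ∈ J, B i * ∑ j ∈ J, ind (Adjacent k i j) ≤ 8 := by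
        calc _ ≤ ∑ i ∈ J, B i * 4 :=
              Finset.sum_le_sum fun i _ => mul_le_mul_of_nonneg_left (hR i) (hBnn i)
          _ = (∑ i ∈ J, B i) * 4 := by rw [Finset.sum_mul]
          _ ≤ 8 := by linarith [sum_endpointCount_le J m]
      have hswap : ∑ i ∈ J, ∑ j ∈ J, ind (Adjacent k i j) * B j =
          ∑ i ∈ J, B i * ∑ j ∈ J, ind (Adjacent k i j) := by
        rw [Finset.sum_comm]
        refine Finset.sum_congr rfl fun i _ => ?_
        rw [Finset.mul_sum]
        refine Finset.sum_congr rfl fun j _ => ?_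
        rw [show Adjacent k j i = Adjacent k i j from propext (adjacent_comm k j i), mul_comm]
      calc ∑ i ∈ J, ∑ j ∈ (J ∩ N i).erase i, e i j ≤ ∑ i ∈ J, ∑ j ∈ J, e i j := by
            refine Finset.sum_le_sum fun i _ => Finset.sum_le_sum_of_subset_of_nonneg
              ((Finset.erase_subset _ _).trans Finset.inter_subset_left) fun j _ _ => henn i j
        _ = 2 / (k : ℝ) ^ 3 * ∑ i ∈ J, ∑ j ∈ J, ind (Adjacent k i j) +
            (∑ i ∈ J, B i * ∑ j ∈ J, ind (Adjacent k i j) +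
              ∑ i ∈ J, ∑ j ∈ J, ind (Adjacent k i j) * B j) / (k : ℝ) ^ 2 := by
            simp only [he, Finset.mul_sum, Finset.sum_div, ← Finset.sum_add_distrib]
            refine Finset.sum_congr rfl fun i _ => Finset.sum_congr rfl fun j _ => ?_
            ring
        _ ≤ 2 / (k : ℝ) ^ 3 * ∑ i ∈ J, 4 + (8 + 8) / (k : ℝ) ^ 2 := by
            rw [hswap]
            gcongr with i hi
            exact hR i
        -- At most `n` windows with four partners each; the endpoint terms are absorbed by `k ≤ n`.
        -- The total `24 * n / k ^ 3` is `72 / k` times the lower bound for the mean.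
        _ ≤ 2 / (k : ℝ) ^ 3 * (n * 4) + 16 * n / (k : ℝ) ^ 3 := by
            have h1 : ((J.card : ℕ) : ℝ) ≤ n := by
              rw [hJ, Finset.card_range]; exact_mod_cast hm
            rw [Finset.sum_const, nsmul_eq_mul]
            have h2 : (8 + 8 : ℝ) / (k : ℝ) ^ 2 ≤ 16 * n / (k : ℝ) ^ 3 := by
              rw [div_le_div_iff₀ (by positivity) (by positivity)]
              nlinarith [mul_le_mul_of_nonneg_right hkn' (sq_nonneg (k : ℝ))]
            gcongr
        _ = 72 / k * (n / (3 * (k : ℝ) ^ 2)) := by field_simp; norm_num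
        _ ≤ _ := by gcongr
    calc _ ≤ 12 / k * lam + 72 / k * lam := add_le_add hfirst hsecond
      _ = _ := by ring

/-! ### Minima of random permutations -/

section Permutations

variable {N : ℕ}

/-- The restriction of `t` to `A` attains its minimum at `a`. -/
def IsMinAt (A : Finset (Fin N)) (a : Fin N) (t : Equiv.Perm (Fin N)) : Prop :=
  ∀ x ∈ A, t a ≤ t x

/-- The function `g` does not change when the values of a permutation on `A` are permuted. -/
def InvariantOn (A : Finset (Fin N)) (g : Equiv.Perm (Fin N) → ℝ) : Prop :=
  ∀ t s : Equiv.Perm (Fin N), (∀ x ∉ A, s x = x) → g (t * s) = g t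

lemma mem_of_fixes_compl {A : Finset (Fin N)} {s : Equiv.Perm (Fin N)} (hs : ∀ x ∉ A, s x = x)
    {x : Fin N} (hx : x ∈ A) : s x ∈ A := by
  by_contra h
  have := s.injective (hs _ h)
  rw [this] at h
  exact h hx

lemma fixes_compl_inv {A : Finset (Fin N)} {s : Equiv.Perm (Fin N)} (hs : ∀ x ∉ A, s x = x) :
    ∀ x ∉ A, s⁻¹ x = x := fun x hx => by
  rw [Equiv.Perm.inv_eq_iff_eq, hs x hx]

lemma isMinAt_mul {A : Finset (Fin N)} {s : Equiv.Perm (Fin N)} (hs : ∀ x ∉ A, s x = x)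
    (a : Fin N) (t : Equiv.Perm (Fin N)) : IsMinAt A a (t * s) ↔ IsMinAt A (s a) t := by
  constructor
  · intro h x hx
    have := h (s⁻¹ x) (mem_of_fixes_compl (fixes_compl_inv hs) hx)
    simpa using this
  · intro h x hx
    exact h _ (mem_of_fixes_compl hs hx)

lemma sum_ind_isMinAt {A : Finset (Fin N)} (hA : A.Nonempty) (t : Equiv.Perm (Fin N)) :
    ∑ b ∈ A, ind (IsMinAt A b t) = 1 := by
  obtain ⟨b, hb, hmin⟩ := A.exists_min_image t hA
  rw [Finset.sum_eq_single b]
  · exact ind_of hmin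
  · intro c hc hcb
    refine ind_of_not fun h => hcb ?_
    exact t.injective (le_antisymm (h b hb) (hmin c hc))
  · exact fun h => absurd hb h

/-- Precomposing with the transposition of `a` and `b` carries a minimum at `b` to one at `a` and
leaves `g` alone. All positions in `A` therefore contribute equally, and exactly one of them is the
minimum. -/
lemma expect_isMinAt_mul {A : Finset (Fin N)} {a : Fin N} (ha : a ∈ A)
    {g : Equiv.Perm (Fin N) → ℝ} (hg : InvariantOn A g) :
    𝔼 t, ind (IsMinAt A a t) * g t = 1 / (A.card : ℝ) * 𝔼 t, g t := by
  have hcard : (A.card : ℝ) ≠ 0 := by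
    exact_mod_cast (Finset.card_pos.2 ⟨a, ha⟩).ne'
  have hterm : ∀ b ∈ A, 𝔼 t, ind (IsMinAt A b t) * g t = 𝔼 t, ind (IsMinAt A a t) * g t := by
    intro b hb
    have hs : ∀ x ∉ A, Equiv.swap a b x = x := fun x hx =>
      Equiv.swap_apply_of_ne_of_ne (fun h => hx (h ▸ ha)) (fun h => hx (h ▸ hb))
    refine Fintype.expect_equiv (Equiv.mulRight (Equiv.swap a b)) _ _ fun t => ?_
    simp only [Equiv.coe_mulRight]
    rw [hg t _ hs, show IsMinAt A a (t * Equiv.swap a b) = IsMinAt A b t from by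
      rw [propext (isMinAt_mul hs a t), Equiv.swap_apply_left]]
  have hsum : ∑ b ∈ A, 𝔼 t, ind (IsMinAt A b t) * g t = 𝔼 t, g t := by
    rw [← Finset.expect_sum_comm]
    refine Finset.expect_congr rfl fun t _ => ?_
    rw [← Finset.sum_mul, sum_ind_isMinAt ⟨a, ha⟩, one_mul]
  rw [Finset.sum_congr rfl hterm, Finset.sum_const, nsmul_eq_mul] at hsum
  rw [← hsum]
  field_simp

/-- The event that the minimum sits at `a` is itself invariant under shuffling `A.erase a`, so the
single-minimum formula applies twice. -/
lemma expect_isMinAt_isMinAt_mul {A : Finset (Fin N)} {a b : Fin N} (ha : a ∈ A) (hb : b ∈ A)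
    (hab : a ≠ b) {g : Equiv.Perm (Fin N) → ℝ} (hg : InvariantOn A g) :
    𝔼 t, ind (IsMinAt A a t ∧ IsMinAt (A.erase a) b t) * g t =
      1 / ((A.card : ℝ) * ((A.card : ℝ) - 1)) * 𝔼 t, g t := by
  have hinv : InvariantOn (A.erase a) fun t => ind (IsMinAt A a t) * g t := by
    intro t s hs
    have hsA : ∀ x ∉ A, s x = x := fun x hx => hs x fun h => hx (Finset.mem_of_mem_erase h)
    simp only
    rw [hg t s hsA, show IsMinAt A a (t * s) = IsMinAt A a t from by
      rw [propext (isMinAt_mul hsA a t), hs a (Finset.notMem_erase a A)]]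
  have h1 := expect_isMinAt_mul (Finset.mem_erase.2 ⟨hab.symm, hb⟩) hinv
  rw [expect_isMinAt_mul ha hg, Finset.card_erase_of_mem ha,
    Nat.cast_sub (Finset.card_pos.2 ⟨a, ha⟩)] at h1
  calc _ = 𝔼 t, ind (IsMinAt (A.erase a) b t) * (ind (IsMinAt A a t) * g t) := by
        refine Finset.expect_congr rfl fun t _ => ?_
        rw [ind_and]; ring
    _ = _ := by
        rw [h1, ← mul_assoc, Nat.cast_one, one_div_mul_one_div_rev]

/-- The positions `x` with `a ≤ x < b`. -/
def window (N a b : ℕ) : Finset (Fin N) := Finset.univ.filter fun x => a ≤ (x : ℕ) ∧ (x : ℕ) < b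

lemma mem_window {a b : ℕ} {x : Fin N} : x ∈ window N a b ↔ a ≤ (x : ℕ) ∧ (x : ℕ) < b := by
  simp [window]

lemma card_window {a b : ℕ} (hb : b ≤ N) : (window N a b).card = b - a := by
  rw [← Nat.card_Ico, ← Finset.card_map Fin.valEmbedding]
  congr 1
  ext x
  simp only [Finset.mem_map, mem_window, Fin.valEmbedding_apply, Finset.mem_Ico]
  exact ⟨fun ⟨y, hy, h⟩ => h ▸ hy, fun h => ⟨⟨x, by omega⟩, h, rfl⟩⟩

/-- Each `I j` looks only at positions from `j - l` to `j + r`; these miss `[a, b)`, so shuffling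
there changes nothing. The sums avoid truncated subtraction. -/
lemma invariantOn_window_occurrences {a b l r : ℕ} {I : ℕ → Equiv.Perm (Fin N) → Prop}
    (hI : ∀ j t t', (∀ x : Fin N, j ≤ (x : ℕ) + l → (x : ℕ) ≤ j + r → t x = t' x) →
      (I j t ↔ I j t'))
    {J : Finset ℕ} (hJ : ∀ j ∈ J, j + r < a ∨ b + l ≤ j) (g : ℕ → ℝ) :
    InvariantOn (window N a b) fun t => g (occurrences J I t) := by
  intro t s hs
  have : occurrences J I (t * s) = occurrences J I t := by
    classical
    unfold occurrences
    refine congrArg Finset.card ?_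
    refine Finset.filter_congr fun j hj => hI j _ _ fun x hx hx' => ?_
    rw [Equiv.Perm.mul_apply, hs x]
    rw [mem_window]
    have := hJ j hj
    omega
  simp only [this]

lemma invariantOn_window_ind {a b l r j : ℕ} {I : ℕ → Equiv.Perm (Fin N) → Prop}
    (hI : ∀ j t t', (∀ x : Fin N, j ≤ (x : ℕ) + l → (x : ℕ) ≤ j + r → t x = t' x) →
      (I j t ↔ I j t'))
    (hj : j + r < a ∨ b + l ≤ j) :
    InvariantOn (window N a b) fun t => ind (I j t) := by
  intro t s hs
  simp only
  congr 1
  refine propext (hI j _ _ fun x hx hx' => ?_)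
  rw [Equiv.Perm.mul_apply, hs x]
  rw [mem_window]
  omega

end Permutations

/-! ### Windows of random binary search trees -/

section Permutations

variable {n k : ℕ}

/-- The keys in `[i, i + k)` form a fringe subtree of the binary search tree in which the key `x` is
inserted at time `t x`: they are inserted later than the adjacent keys. -/
def BSTWindow (n k i : ℕ) (t : Equiv.Perm (Fin n)) : Prop :=
  ∀ x y : Fin n, i ≤ (x : ℕ) → (x : ℕ) < i + k → ((y : ℕ) + 1 = i ∨ (y : ℕ) = i + k) → t y < t x

/-- The probability of `BSTWindow n k i`. -/
noncomputable def bstWindowProb (n k i : ℕ) : ℝ :=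
  if i = 0 ∨ i = n - k then 1 / ((k : ℝ) + 1) else 2 / (((k : ℝ) + 1) * ((k : ℝ) + 2))

lemma bstWindow_congr (n k j : ℕ) (t t' : Equiv.Perm (Fin n))
    (h : ∀ x : Fin n, j ≤ (x : ℕ) + 1 → (x : ℕ) ≤ j + k → t x = t' x) :
    BSTWindow n k j t ↔ BSTWindow n k j t' := by
  unfold BSTWindow
  refine forall_congr' fun x => forall_congr' fun y => ?_
  refine imp_congr_right fun h1 => imp_congr_right fun h2 => imp_congr_right fun h3 => ?_
  rw [h x (by omega) (by omega), h y (by omega) (by omega)]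

lemma bstWindow_zero_iff (hkn : k < n) (t : Equiv.Perm (Fin n)) :
    BSTWindow n k 0 t ↔ IsMinAt (window n 0 (k + 1)) ⟨k, hkn⟩ t := by
  constructor
  · intro h x hx
    rw [mem_window] at hx
    by_cases hxk : (x : ℕ) = k
    · exact le_of_eq (congrArg t (Fin.ext hxk.symm))
    · exact (h x ⟨k, hkn⟩ (by omega) (by omega) (by simp)).le
  · intro h x y _ hx hy
    have hyk : y = ⟨k, hkn⟩ := Fin.ext (by simp; omega)
    subst hyk
    refine lt_of_le_of_ne (h x (mem_window.2 (by omega))) fun e => ?_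
    have := Fin.ext_iff.1 (t.injective e)
    simp at this; omega

lemma bstWindow_last_iff (hkn : k < n) (t : Equiv.Perm (Fin n)) :
    BSTWindow n k (n - k) t ↔ IsMinAt (window n (n - k - 1) n) ⟨n - k - 1, by omega⟩ t := by
  constructor
  · intro h x hx
    rw [mem_window] at hx
    by_cases hxk : (x : ℕ) = n - k - 1
    · exact le_of_eq (congrArg t (Fin.ext hxk.symm))
    · exact (h x ⟨n - k - 1, by omega⟩ (by omega) (by omega) (by left; simp; omega)).le
  · intro h x y hx hx' hy
    have hyk : y = ⟨n - k - 1, by omega⟩ := Fin.ext (by simp; omega)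
    subst hyk
    refine lt_of_le_of_ne (h x (mem_window.2 (by omega))) fun e => ?_
    have := Fin.ext_iff.1 (t.injective e)
    simp at this; omega

/-- An interior window occurs when the two earliest of its `k + 2` relevant keys are the two outer
ones; the disjoint cases are the two orders in which these arrive. -/
lemma ind_bstWindow {i : ℕ} (hi : 0 < i) (hin : i < n - k) (t : Equiv.Perm (Fin n)) :
    ind (BSTWindow n k i t) =
      ind (IsMinAt (window n (i - 1) (i + k + 1)) ⟨i - 1, by omega⟩ t ∧
        IsMinAt ((window n (i - 1) (i + k + 1)).erase ⟨i - 1, by omega⟩) ⟨i + k, by omega⟩ t) +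
      ind (IsMinAt (window n (i - 1) (i + k + 1)) ⟨i + k, by omega⟩ t ∧
        IsMinAt ((window n (i - 1) (i + k + 1)).erase ⟨i + k, by omega⟩) ⟨i - 1, by omega⟩ t) := by
  set a : Fin n := ⟨i - 1, by omega⟩ with ha
  set b : Fin n := ⟨i + k, by omega⟩ with hb
  set A := window n (i - 1) (i + k + 1) with hA
  have hab : a ≠ b := by rw [Ne, Fin.ext_iff]; simp [ha, hb]; omega
  have haA : a ∈ A := mem_window.2 (by simp [ha]; omega)
  have hbA : b ∈ A := mem_window.2 (by simp [hb]; omega)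
  have hin' : ∀ x : Fin n, (x ∈ A ∧ x ≠ a ∧ x ≠ b) ↔ (i ≤ (x : ℕ) ∧ (x : ℕ) < i + k) := by
    intro x
    simp only [hA, mem_window, Ne, Fin.ext_iff, ha, hb]; omega
  have hside : ∀ y : Fin n, ((y : ℕ) + 1 = i ∨ (y : ℕ) = i + k) ↔ (y = a ∨ y = b) := by
    intro y
    simp only [Fin.ext_iff, ha, hb]; omega
  have hW : BSTWindow n k i t ↔ ∀ x, (x ∈ A ∧ x ≠ a ∧ x ≠ b) → t a < t x ∧ t b < t x := by
    constructor
    · intro h x hx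
      have hx' := (hin' x).1 hx
      exact ⟨h x a hx'.1 hx'.2 ((hside a).2 (Or.inl rfl)),
        h x b hx'.1 hx'.2 ((hside b).2 (Or.inr rfl))⟩
    · intro h x y h1 h2 h3
      have := h x ((hin' x).2 ⟨h1, h2⟩)
      rcases (hside y).1 h3 with rfl | rfl
      · exact this.1
      · exact this.2
  have key : ∀ c d : Fin n, c ≠ d → c ∈ A → d ∈ A → ((IsMinAt A c t ∧ IsMinAt (A.erase c) d t) ↔
      (t c < t d ∧ ∀ x, (x ∈ A ∧ x ≠ c ∧ x ≠ d) → t c < t x ∧ t d < t x)) := by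
    intro c d hcd hc hd
    have hne : ∀ {x y : Fin n}, x ≠ y → t x ≠ t y := fun h h' => h (t.injective h')
    constructor
    · rintro ⟨h1, h2⟩
      refine ⟨lt_of_le_of_ne (h1 d hd) (hne hcd), fun x hx => ⟨?_, ?_⟩⟩
      · exact lt_of_le_of_ne (h1 x hx.1) (hne hx.2.1.symm)
      · exact lt_of_le_of_ne (h2 x (Finset.mem_erase.2 ⟨hx.2.1, hx.1⟩)) (hne hx.2.2.symm)
    · rintro ⟨h1, h2⟩
      have hmin : ∀ x ∈ A, x ≠ c → t d ≤ t x := by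
        intro x hx hxc
        by_cases hxd : x = d
        · rw [hxd]
        · exact (h2 x ⟨hx, hxc, hxd⟩).2.le
      refine ⟨fun x hx => ?_, fun x hx => hmin x (Finset.mem_of_mem_erase hx)
        (Finset.ne_of_mem_erase hx)⟩
      by_cases hxc : x = c
      · rw [hxc]
      · exact h1.le.trans (hmin x hx hxc)
  have k1 := key a b hab haA hbA
  have k2 := key b a hab.symm hbA haA
  by_cases h : BSTWindow n k i t
  · rw [ind_of h]
    have h' := hW.1 h
    rcases lt_or_gt_of_ne (fun e => hab (t.injective e) : t a ≠ t b) with hlt | hlt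
    · rw [ind_of (k1.2 ⟨hlt, h'⟩), ind_of_not fun h2 => (k2.1 h2).1.not_gt hlt, add_zero]
    · rw [ind_of (k2.2 ⟨hlt, fun x hx => (h' x ⟨hx.1, hx.2.2, hx.2.1⟩).symm⟩),
        ind_of_not fun h2 => (k1.1 h2).1.not_gt hlt, zero_add]
  · rw [ind_of_not h, ind_of_not fun h1 => h (hW.2 (k1.1 h1).2),
      ind_of_not fun h1 => h (hW.2 fun x hx => ((k2.1 h1).2 x ⟨hx.1, hx.2.2, hx.2.1⟩).symm),
      add_zero]

/-- At either end there is only one adjacent key, hence one minimum among `k + 1` keys. The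
truncated `i - 1` makes the same interval serve at `i = 0`. -/
lemma expect_bstWindow_mul (hkn : k < n) {i : ℕ} (hi : i ≤ n - k)
    {g : Equiv.Perm (Fin n) → ℝ} (hg : InvariantOn (window n (i - 1) (i + k + 1)) g) :
    𝔼 t, ind (BSTWindow n k i t) * g t = bstWindowProb n k i * 𝔼 t, g t := by
  rcases Nat.eq_zero_or_pos i with rfl | hi0
  · simp only [propext (bstWindow_zero_iff hkn _)]
    rw [zero_tsub, zero_add] at hg
    rw [expect_isMinAt_mul (mem_window.2 (by simp)) hg, card_window (by omega), bstWindowProb,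
      if_pos (Or.inl rfl)]
    simp
  rcases hi.eq_or_lt with rfl | hin
  · simp only [propext (bstWindow_last_iff hkn _)]
    have hw : window n (n - k - 1) (n - k + k + 1) = window n (n - k - 1) n := by
      ext x; rw [mem_window, mem_window]; omega
    rw [hw] at hg
    rw [expect_isMinAt_mul (mem_window.2 (by simp; omega)) hg, card_window le_rfl, bstWindowProb,
      if_pos (Or.inr rfl), show n - (n - k - 1) = k + 1 by omega]
    simp
  · simp only [ind_bstWindow hi0 hin, add_mul, Finset.expect_add_distrib]
    have hab : (⟨i - 1, by omega⟩ : Fin n) ≠ ⟨i + k, by omega⟩ := by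
      rw [Ne, Fin.ext_iff]; simp; omega
    have ha : (⟨i - 1, by omega⟩ : Fin n) ∈ window n (i - 1) (i + k + 1) :=
      mem_window.2 (by simp; omega)
    have hb : (⟨i + k, by omega⟩ : Fin n) ∈ window n (i - 1) (i + k + 1) :=
      mem_window.2 (by simp; omega)
    rw [expect_isMinAt_isMinAt_mul ha hb hab hg, expect_isMinAt_isMinAt_mul hb ha hab.symm hg,
      card_window (by omega), bstWindowProb, if_neg (by omega),
      show i + k + 1 - (i - 1) = k + 2 by omega]
    push_cast
    have h1 : (k : ℝ) + 2 ≠ 0 := by positivity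
    have h2 : (k : ℝ) + 1 ≠ 0 := by positivity
    rw [show (k : ℝ) + 2 - 1 = k + 1 by ring]
    field_simp
    ring

lemma bstWindowProb_le (hk : 1 ≤ k) (i : ℕ) :
    bstWindowProb n k i ≤ 2 / (k : ℝ) ^ 2 + endpointCount (n - k) i / k := by
  have hk0 : (0 : ℝ) < k := by exact_mod_cast hk
  unfold bstWindowProb
  split_ifs with h
  · have h1 : (1 : ℝ) ≤ endpointCount (n - k) i := by
      unfold endpointCount
      have h0 := ind_nonneg (i = 0)
      have h0' := ind_nonneg (i = n - k)
      rcases h with h | h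
      · rw [ind_of h]; linarith
      · rw [ind_of h]; linarith
    have h2 : 1 / ((k : ℝ) + 1) ≤ 1 / k := one_div_le_one_div_of_le hk0 (by linarith)
    have h3 : 1 / (k : ℝ) ≤ endpointCount (n - k) i / k := by gcongr
    have h4 : (0 : ℝ) ≤ 2 / (k : ℝ) ^ 2 := by positivity
    linarith
  · have h1 : 2 / (((k : ℝ) + 1) * ((k : ℝ) + 2)) ≤ 2 / (k : ℝ) ^ 2 := by
      gcongr; nlinarith
    have h2 : 0 ≤ endpointCount (n - k) i / k := div_nonneg (endpointCount_nonneg _ _) hk0.le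
    linarith

lemma sum_bstWindowProb (hkn : k < n) :
    ∑ i ∈ Finset.range (n - k + 1), bstWindowProb n k i =
      2 * ((n : ℝ) + 1) / (((k : ℝ) + 1) * ((k : ℝ) + 2)) := by
  obtain ⟨d, rfl⟩ : ∃ d, n = k + 1 + d := ⟨n - k - 1, by omega⟩
  rw [show k + 1 + d - k + 1 = d + 1 + 1 by omega, Finset.sum_range_succ, Finset.sum_range_succ']
  have h : ∀ i ∈ Finset.range d, bstWindowProb (k + 1 + d) k (i + 1) =
      2 / (((k : ℝ) + 1) * ((k : ℝ) + 2)) := by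
    intro i hi
    rw [Finset.mem_range] at hi
    rw [bstWindowProb, if_neg (by omega)]
  rw [Finset.sum_congr rfl h, bstWindowProb, if_pos (Or.inl rfl), bstWindowProb,
    if_pos (Or.inr (by omega))]
  have h1 : (k : ℝ) + 2 ≠ 0 := by positivity
  have h2 : (k : ℝ) + 1 ≠ 0 := by positivity
  simp only [Finset.sum_const, Finset.card_range, nsmul_eq_mul]
  push_cast
  field_simp
  ring

lemma expect_bstWindow (hkn : k < n) {i : ℕ} (hi : i ≤ n - k) :
    𝔼 t, ind (BSTWindow n k i t) = bstWindowProb n k i := by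
  have := expect_bstWindow_mul hkn hi (g := fun _ => 1) fun _ _ _ => rfl
  simpa using this

/-- Of the pairs in range, only windows separated by exactly one key can occur together. Although
they share that key, one window may be relaxed to its far boundary alone, which costs `1 / (k + 1)`
and is independent of the other window. -/
lemma expect_bstWindow_pair_le (hk : 1 ≤ k) (hkn : 2 * k + 1 < n) {i j : ℕ} (hij : i < j)
    (hj : j ≤ n - k) (hji : j ≤ i + k + 1) :
    𝔼 t, ind (BSTWindow n k i t) * ind (BSTWindow n k j t) ≤
      ind (Adjacent k i j) * (2 / (k : ℝ) ^ 3 +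
        (endpointCount (n - k) i + endpointCount (n - k) j) / (k : ℝ) ^ 2) := by
  have hk0 : (0 : ℝ) < k := by exact_mod_cast hk
  have hBi := endpointCount_nonneg (n - k) i
  have hBj := endpointCount_nonneg (n - k) j
  rcases Nat.lt_or_ge (i + k) j with hlt | hle
  · obtain rfl : j = i + k + 1 := by omega
    rw [ind_of (show Adjacent k i (i + k + 1) by unfold Adjacent; omega), one_mul]
    have hfac : ∀ p B : ℝ, 0 ≤ p → 0 ≤ B → p ≤ 2 / (k : ℝ) ^ 2 + B / k →
        1 / ((k : ℝ) + 1) * p ≤ 2 / (k : ℝ) ^ 3 + B / (k : ℝ) ^ 2 := by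
      intro p B hp hB h
      calc 1 / ((k : ℝ) + 1) * p ≤ 1 / k * (2 / (k : ℝ) ^ 2 + B / k) := by
            gcongr; linarith
        _ = _ := by field_simp
    have hnn : ∀ i, 0 ≤ bstWindowProb n k i := fun i => by
      unfold bstWindowProb; split_ifs <;> positivity
    -- The first window has no left boundary, so the second one is relaxed to its right boundary `2
    -- * k + 1`; this is where `2 * k + 1 < n` is needed.
    rcases Nat.eq_zero_or_pos i with rfl | hi0
    · have himp : ∀ t, BSTWindow n k (0 + k + 1) t →
          IsMinAt (window n (k + 1) (2 * k + 2)) ⟨2 * k + 1, hkn⟩ t := by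
        intro t h x hx
        rw [mem_window] at hx
        by_cases hxk : (x : ℕ) = 2 * k + 1
        · exact le_of_eq (congrArg t (Fin.ext hxk.symm))
        · exact (h x ⟨2 * k + 1, hkn⟩ (by omega) (by omega) (by right; simp; omega)).le
      have hinv := invariantOn_window_ind (a := k + 1) (b := 2 * k + 2) (j := 0)
        (fun j t t' h => bstWindow_congr n k j t t' h) (Or.inl (by omega))
      calc _ ≤ 𝔼 t, ind (IsMinAt (window n (k + 1) (2 * k + 2)) ⟨2 * k + 1, hkn⟩ t) *
              ind (BSTWindow n k 0 t) := by
            refine Finset.expect_le_expect fun t _ => ?_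
            rw [mul_comm]
            exact mul_le_mul_of_nonneg_right (ind_mono (himp t)) (ind_nonneg _)
        _ = 1 / ((k : ℝ) + 1) * bstWindowProb n k 0 := by
            rw [expect_isMinAt_mul (mem_window.2 (by simp; omega)) hinv, card_window (by omega),
              expect_bstWindow (by omega) (by omega), show 2 * k + 2 - (k + 1) = k + 1 by omega]
            push_cast; rfl
        _ ≤ _ := hfac _ _ (hnn 0) hBi (bstWindowProb_le hk 0)
        _ ≤ _ := by gcongr; linarith
    · have himp : ∀ t, BSTWindow n k i t →
          IsMinAt (window n (i - 1) (i + k)) ⟨i - 1, by omega⟩ t := by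
        intro t h x hx
        rw [mem_window] at hx
        by_cases hxk : (x : ℕ) = i - 1
        · exact le_of_eq (congrArg t (Fin.ext hxk.symm))
        · exact (h x ⟨i - 1, by omega⟩ (by omega) (by omega) (by left; simp; omega)).le
      have hinv := invariantOn_window_ind (a := i - 1) (b := i + k) (j := i + k + 1)
        (fun j t t' h => bstWindow_congr n k j t t' h) (Or.inr (by omega))
      calc _ ≤ 𝔼 t, ind (IsMinAt (window n (i - 1) (i + k)) ⟨i - 1, by omega⟩ t) *
              ind (BSTWindow n k (i + k + 1) t) := by
            refine Finset.expect_le_expect fun t _ => ?_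
            exact mul_le_mul_of_nonneg_right (ind_mono (himp t)) (ind_nonneg _)
        _ = 1 / ((k : ℝ) + 1) * bstWindowProb n k (i + k + 1) := by
            rw [expect_isMinAt_mul (mem_window.2 (by simp; omega)) hinv, card_window (by omega),
              expect_bstWindow (by omega) hj, show i + k - (i - 1) = k + 1 by omega]
            push_cast; rfl
        _ ≤ _ := hfac _ _ (hnn _) hBj (bstWindowProb_le hk _)
        _ ≤ _ := by gcongr; linarith
  -- The key `j - 1` lies in the first window and borders the second, while `i + k` borders the
  -- first and lies in the second: each would have to precede the other.
  · have h0 : ∀ t, ind (BSTWindow n k i t) * ind (BSTWindow n k j t) = 0 := by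
      intro t
      rw [← ind_and]
      refine ind_of_not fun ⟨h1, h2⟩ => ?_
      have hx := h1 ⟨j - 1, by omega⟩ ⟨i + k, by omega⟩ (by simp; omega) (by simp; omega)
        (Or.inr rfl)
      have hy := h2 ⟨i + k, by omega⟩ ⟨j - 1, by omega⟩ hle (by simp; omega)
        (Or.inl (by simp; omega))
      exact hx.not_gt hy
    simp only [h0, Finset.expect_const_zero]
    have := ind_nonneg (Adjacent k i j)
    positivity

theorem abs_expect_bstWindow_sub_poisson_le (hk : 1 ≤ k) (hkn : 2 * k + 1 < n) (A : Set ℕ) :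
    |𝔼 t, ind (occurrences (Finset.range (n - k + 1)) (BSTWindow n k) t ∈ A) -
        ∑' l, A.indicator
          (poissonWeight (2 * ((n : ℝ) + 1) / (((k : ℝ) + 1) * ((k : ℝ) + 2)))) l| ≤ 84 / k := by
  rw [← sum_bstWindowProb (by omega)]
  refine abs_expect_sub_poisson_le_of_windows n k (n - k) hk (by omega) (by omega)
    (BSTWindow n k) (bstWindowProb n k) (fun i _ => bstWindowProb_le hk i)
    (fun i j h1 h2 h3 => expect_bstWindow_pair_le hk hkn h1 h2 h3) ?_ ?_ A
  · intro i hi J hJ g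
    refine expect_bstWindow_mul (by omega) hi
      (invariantOn_window_occurrences (l := 1) (r := k)
        (fun j t t' h => bstWindow_congr n k j t t' h) (fun j hj => ?_) g)
    have := (hJ j hj).2
    omega
  · rw [sum_bstWindowProb (by omega)]
    have hk' : (1 : ℝ) ≤ k := by exact_mod_cast hk
    have hn : (0 : ℝ) ≤ n := by positivity
    rw [div_le_div_iff₀ (by positivity) (by positivity)]
    nlinarith [mul_nonneg hn (by nlinarith : (0 : ℝ) ≤ 6 * (k : ℝ) ^ 2 - (k + 1) * (k + 2)),
      sq_nonneg (k : ℝ)]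

end Permutations

/-! ### Windows of random recursive trees -/

section Permutations

variable {N k : ℕ}

/-- The labels at the positions in `[i, i + k)` form a fringe subtree of the recursive tree in
which the parent of a label is the last smaller label before it: the label at `i` is the smallest
one of these, and larger than the label at `i + k`. -/
def RRTWindow (N k i : ℕ) (t : Equiv.Perm (Fin N)) : Prop :=
  ∀ p : Fin N, (p : ℕ) = i → (∀ x : Fin N, i < (x : ℕ) → (x : ℕ) < i + k → t p < t x) ∧
    ∀ y : Fin N, (y : ℕ) = i + k → t y < t p

/-- The probability of `RRTWindow N k i`. -/
noncomputable def rrtWindowProb (N k i : ℕ) : ℝ :=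
  if i = N - k then 1 / (k : ℝ) else 1 / ((k : ℝ) * ((k : ℝ) + 1))

lemma rrtWindow_congr (N k j : ℕ) (t t' : Equiv.Perm (Fin N))
    (h : ∀ x : Fin N, j ≤ (x : ℕ) + 0 → (x : ℕ) ≤ j + k → t x = t' x) :
    RRTWindow N k j t ↔ RRTWindow N k j t' := by
  unfold RRTWindow
  refine forall_congr' fun p => imp_congr_right fun h1 => and_congr ?_ ?_
  · refine forall_congr' fun x => imp_congr_right fun h2 => imp_congr_right fun h3 => ?_
    rw [h x (by omega) (by omega), h p (by omega) (by omega)]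
  · refine forall_congr' fun y => imp_congr_right fun h2 => ?_
    rw [h y (by omega) (by omega), h p (by omega) (by omega)]

lemma RRTWindow.isMinAt {i : ℕ} {t : Equiv.Perm (Fin N)} (h : RRTWindow N k i t) (hi : i < N) :
    IsMinAt (window N i (i + k)) ⟨i, hi⟩ t := by
  intro x hx
  rw [mem_window] at hx
  by_cases hxi : (x : ℕ) = i
  · exact le_of_eq (congrArg t (Fin.ext hxi.symm))
  · exact ((h ⟨i, hi⟩ rfl).1 x (by omega) hx.2).le

lemma rrtWindow_last_iff (hk : 1 ≤ k) (hkN : k ≤ N) (t : Equiv.Perm (Fin N)) :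
    RRTWindow N k (N - k) t ↔ IsMinAt (window N (N - k) N) ⟨N - k, by omega⟩ t := by
  constructor
  · intro h
    have := h.isMinAt (show N - k < N by omega)
    rwa [Nat.sub_add_cancel hkN] at this
  · intro h p hp
    have hlt : N - k < N := by omega
    obtain rfl : p = ⟨N - k, hlt⟩ := Fin.ext hp
    refine ⟨fun x hx hx' => lt_of_le_of_ne (h x (mem_window.2 (by omega))) fun e => ?_,
      fun y hy => ?_⟩
    · have := Fin.ext_iff.1 (t.injective e)
      simp only at this; omega
    · omega

/-- Among `k + 1` consecutive labels, the last is the smallest and the first the second smallest;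
this gives the probability `1 / (k * (k + 1))`. -/
lemma rrtWindow_iff {i : ℕ} (hk : 1 ≤ k) (hi : i + k < N) (t : Equiv.Perm (Fin N)) :
    RRTWindow N k i t ↔ IsMinAt (window N i (i + k + 1)) ⟨i + k, hi⟩ t ∧
      IsMinAt ((window N i (i + k + 1)).erase ⟨i + k, hi⟩) ⟨i, by omega⟩ t := by
  have hers : ∀ x, x ∈ (window N i (i + k + 1)).erase ⟨i + k, hi⟩ ↔ x ∈ window N i (i + k) := by
    intro x
    simp only [Finset.mem_erase, mem_window, Ne, Fin.ext_iff]; omega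
  constructor
  · intro h
    have hmin := h.isMinAt (show i < N by omega)
    have hlt := (h ⟨i, by omega⟩ rfl).2 ⟨i + k, hi⟩ rfl
    refine ⟨fun x hx => ?_, fun x hx => hmin x ((hers x).1 hx)⟩
    by_cases hxi : x = ⟨i + k, hi⟩
    · rw [hxi]
    · exact hlt.le.trans (hmin x ((hers x).1 (Finset.mem_erase.2 ⟨hxi, hx⟩)))
  · rintro ⟨h1, h2⟩ p hp
    have hlt : i < N := by omega
    obtain rfl : p = ⟨i, hlt⟩ := Fin.ext hp
    refine ⟨fun x hx hx' => ?_, fun y hy => ?_⟩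
    · refine lt_of_le_of_ne (h2 x ((hers x).2 (mem_window.2 (by omega)))) fun e => ?_
      have := Fin.ext_iff.1 (t.injective e)
      simp only at this; omega
    · obtain rfl : y = ⟨i + k, hi⟩ := Fin.ext hy
      refine lt_of_le_of_ne (h1 _ (mem_window.2 (by simp))) fun e => ?_
      have := Fin.ext_iff.1 (t.injective e)
      simp only at this; omega

lemma expect_rrtWindow_mul (hk : 1 ≤ k) (hkN : k ≤ N) {i : ℕ} (hi : i ≤ N - k)
    {g : Equiv.Perm (Fin N) → ℝ} (hg : InvariantOn (window N i (i + k + 1)) g) :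
    𝔼 t, ind (RRTWindow N k i t) * g t = rrtWindowProb N k i * 𝔼 t, g t := by
  rcases hi.eq_or_lt with rfl | hin
  · simp only [propext (rrtWindow_last_iff hk hkN _)]
    have hw : window N (N - k) (N - k + k + 1) = window N (N - k) N := by
      ext x; rw [mem_window, mem_window]; omega
    rw [hw] at hg
    rw [expect_isMinAt_mul (mem_window.2 (by simp; omega)) hg, card_window le_rfl, rrtWindowProb,
      if_pos rfl, Nat.sub_sub_self hkN]
  · simp only [propext (rrtWindow_iff hk (show i + k < N by omega) _)]
    rw [expect_isMinAt_isMinAt_mul (mem_window.2 (by simp)) (mem_window.2 (by simp))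
      (by rw [Ne, Fin.ext_iff]; simp; omega) hg, card_window (by omega), rrtWindowProb,
      if_neg (by omega), show i + k + 1 - i = k + 1 by omega]
    push_cast
    rw [add_sub_cancel_right, mul_comm (k : ℝ)]

lemma rrtWindowProb_le (hk : 1 ≤ k) (i : ℕ) :
    rrtWindowProb N k i ≤ 2 / (k : ℝ) ^ 2 + endpointCount (N - k) i / k := by
  have hk0 : (0 : ℝ) < k := by exact_mod_cast hk
  unfold rrtWindowProb
  split_ifs with h
  · have h1 : (1 : ℝ) ≤ endpointCount (N - k) i := by
      unfold endpointCount
      rw [ind_of h]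
      linarith [ind_nonneg (i = 0)]
    have h3 : 1 / (k : ℝ) ≤ endpointCount (N - k) i / k := by gcongr
    have h4 : (0 : ℝ) ≤ 2 / (k : ℝ) ^ 2 := by positivity
    linarith
  · have h1 : 1 / ((k : ℝ) * ((k : ℝ) + 1)) ≤ 2 / (k : ℝ) ^ 2 := by
      gcongr
      · norm_num
      · nlinarith
    have h2 : 0 ≤ endpointCount (N - k) i / k := div_nonneg (endpointCount_nonneg _ _) hk0.le
    linarith

lemma sum_rrtWindowProb (hk : 1 ≤ k) (hkN : k ≤ N) :
    ∑ i ∈ Finset.range (N - k + 1), rrtWindowProb N k i =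
      ((N : ℝ) + 1) / ((k : ℝ) * ((k : ℝ) + 1)) := by
  rw [Finset.sum_range_succ]
  have h : ∀ i ∈ Finset.range (N - k), rrtWindowProb N k i =
      1 / ((k : ℝ) * ((k : ℝ) + 1)) := by
    intro i hi
    rw [Finset.mem_range] at hi
    rw [rrtWindowProb, if_neg (by omega)]
  rw [Finset.sum_congr rfl h, rrtWindowProb, if_pos rfl]
  have h1 : (k : ℝ) ≠ 0 := by exact_mod_cast (by omega : k ≠ 0)
  have h2 : (k : ℝ) + 1 ≠ 0 := by positivity
  simp only [Finset.sum_const, Finset.card_range, nsmul_eq_mul]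
  rw [Nat.cast_sub hkN]
  field_simp
  ring

lemma expect_rrtWindow (hk : 1 ≤ k) (hkN : k ≤ N) {i : ℕ} (hi : i ≤ N - k) :
    𝔼 t, ind (RRTWindow N k i t) = rrtWindowProb N k i := by
  have := expect_rrtWindow_mul hk hkN hi (g := fun _ => 1) fun _ _ _ => rfl
  simpa using this

/-- Overlapping windows would force `t i < t j < t (i + k) < t i`. Otherwise, the first window is
relaxed to a minimum on `[i, i + k)`, which the second window does not see. No left boundary is
involved, so there is no exceptional range of `N`. -/
lemma expect_rrtWindow_pair_le (hk : 1 ≤ k) (hkN : k ≤ N) {i j : ℕ} (hij : i < j)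
    (hj : j ≤ N - k) (hji : j ≤ i + k + 1) :
    𝔼 t, ind (RRTWindow N k i t) * ind (RRTWindow N k j t) ≤
      ind (Adjacent k i j) * (2 / (k : ℝ) ^ 3 +
        (endpointCount (N - k) i + endpointCount (N - k) j) / (k : ℝ) ^ 2) := by
  have hk0 : (0 : ℝ) < k := by exact_mod_cast hk
  have hBi := endpointCount_nonneg (N - k) i
  have hBj := endpointCount_nonneg (N - k) j
  rcases Nat.lt_or_ge j (i + k) with hlt | hle
  · have h0 : ∀ t, ind (RRTWindow N k i t) * ind (RRTWindow N k j t) = 0 := by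
      intro t
      rw [← ind_and]
      refine ind_of_not fun ⟨h1, h2⟩ => ?_
      have hi' := h1 ⟨i, by omega⟩ rfl
      have hx := hi'.1 ⟨j, by omega⟩ hij hlt
      have hy := hi'.2 ⟨i + k, by omega⟩ rfl
      have hz := (h2 ⟨j, by omega⟩ rfl).1 ⟨i + k, by omega⟩ hlt (by simp; omega)
      exact (hx.trans hz).not_gt hy
    simp only [h0, Finset.expect_const_zero]
    have := ind_nonneg (Adjacent k i j)
    positivity
  · rw [ind_of (show Adjacent k i j by unfold Adjacent; omega), one_mul]
    have hinv := invariantOn_window_ind (a := i) (b := i + k) (j := j)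
      (fun j t t' h => rrtWindow_congr N k j t t' h) (Or.inr (by omega))
    calc _ ≤ 𝔼 t, ind (IsMinAt (window N i (i + k)) ⟨i, by omega⟩ t) *
            ind (RRTWindow N k j t) := by
          refine Finset.expect_le_expect fun t _ => ?_
          exact mul_le_mul_of_nonneg_right
            (ind_mono fun h : RRTWindow N k i t => h.isMinAt (by omega)) (ind_nonneg _)
      _ = 1 / (k : ℝ) * rrtWindowProb N k j := by
          rw [expect_isMinAt_mul (mem_window.2 (by simp; omega)) hinv, card_window (by omega),
            expect_rrtWindow hk hkN hj, Nat.add_sub_cancel_left]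
      _ ≤ 1 / (k : ℝ) * (2 / (k : ℝ) ^ 2 + endpointCount (N - k) j / k) := by
          gcongr
          exact rrtWindowProb_le hk j
      _ = 2 / (k : ℝ) ^ 3 + endpointCount (N - k) j / (k : ℝ) ^ 2 := by field_simp
      _ ≤ _ := by gcongr; linarith

theorem abs_expect_rrtWindow_sub_poisson_le (hk : 1 ≤ k) (hkN : k ≤ N) (A : Set ℕ) :
    |𝔼 t, ind (occurrences (Finset.range (N - k + 1)) (RRTWindow N k) t ∈ A) -
        ∑' l, A.indicator
          (poissonWeight (((N : ℝ) + 1) / ((k : ℝ) * ((k : ℝ) + 1)))) l| ≤ 84 / k := by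
  rw [← sum_rrtWindowProb hk hkN]
  -- The tree has `N + 1` nodes, but its word has only `N` free positions since the root label is
  -- fixed in front.
  refine abs_expect_sub_poisson_le_of_windows (N + 1) k (N - k) hk (by omega) (by omega)
    (RRTWindow N k) (rrtWindowProb N k) (fun i _ => rrtWindowProb_le hk i)
    (fun i j h1 h2 h3 => expect_rrtWindow_pair_le hk hkN h1 h2 h3) ?_ ?_ A
  · intro i hi J hJ g
    refine expect_rrtWindow_mul hk hkN hi
      (invariantOn_window_occurrences (l := 0) (r := k)
        (fun j t t' h => rrtWindow_congr N k j t t' h) (fun j hj => ?_) g)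
    have := (hJ j hj).2
    omega
  · rw [sum_rrtWindowProb hk hkN]
    have hk' : (1 : ℝ) ≤ k := by exact_mod_cast hk
    push_cast
    refine div_le_div_of_nonneg_left (by positivity) (by positivity) ?_
    nlinarith

end Permutations

/-! ### Fringe subtrees of binary search trees as windows -/

section BinarySearchTrees

lemma foldl_bstInsert_node {α : Type*} [LinearOrder α] (xs : List α) (a : α)
    (l r : BinaryTree α) :
    xs.foldl (fun t x => bstInsert x t) (.node a l r) =
      .node a ((xs.filter (· < a)).foldl (fun t x => bstInsert x t) l)
        ((xs.filter (fun x => ¬ x < a)).foldl (fun t x => bstInsert x t) r) := by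
  induction xs generalizing l r with
  | nil => rfl
  | cons x xs ih =>
    rw [List.foldl_cons, bstInsert]
    by_cases h : x < a
    · rw [if_pos h, ih]
      simp [h]
    · rw [if_neg h, ih, List.filter_cons_of_neg (by simpa using h),
        List.filter_cons_of_pos (by simpa using h), List.foldl_cons]

lemma bstOfList_cons {α : Type*} [LinearOrder α] (a : α) (xs : List α) :
    bstOfList (a :: xs) =
      .node a (bstOfList (xs.filter (· < a))) (bstOfList (xs.filter (fun x => ¬ x < a))) :=
  foldl_bstInsert_node xs a .nil .nil

lemma numNodes_bstInsert {α : Type*} [LinearOrder α] (x : α) (t : BinaryTree α) :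
    (bstInsert x t).numNodes = t.numNodes + 1 := by
  induction t with
  | nil => rfl
  | node a l r ihl ihr =>
    rw [bstInsert]
    split_ifs
    · simp only [BinaryTree.numNodes, ihl]; omega
    · simp only [BinaryTree.numNodes, ihr]; omega

lemma numNodes_bstOfList {α : Type*} [LinearOrder α] (xs : List α) :
    (bstOfList xs).numNodes = xs.length := by
  suffices h : ∀ t : BinaryTree α,
      (xs.foldl (fun t x => bstInsert x t) t).numNodes = t.numNodes + xs.length by
    simpa [BinaryTree.numNodes, bstOfList] using h .nil
  induction xs with
  | nil => intro t; rfl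
  | cons x xs ih =>
    intro t
    rw [List.foldl_cons, ih, numNodes_bstInsert, List.length_cons]; omega

/-- The keys in `[i, i + k)` form a fringe subtree of the binary search tree built from the keys
in `[a, b)`. -/
def LocalBSTWindow {n : ℕ} (k a b : ℕ) (t : Equiv.Perm (Fin n)) (i : ℕ) : Prop :=
  ∀ x y : Fin n, i ≤ (x : ℕ) → (x : ℕ) < i + k →
    (((y : ℕ) + 1 = i ∧ a ≤ (y : ℕ)) ∨ ((y : ℕ) = i + k ∧ (y : ℕ) < b)) → t y < t x

-- Induction along the recursive structure of the tree: the earliest key `c` is the root and splits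
-- `[a, b)`. A window contains `c`, lies left of it or lies right of it. Boundary keys outside `[a,
-- b)` are ignored by the local condition.
open scoped Classical in
theorem bstFringeCount_bstOfList {n : ℕ} (k : ℕ) (hk : 1 ≤ k) (t : Equiv.Perm (Fin n))
    (xs : List (Fin n)) (a b : ℕ) (hab : a ≤ b) (hb : b ≤ n)
    (hsort : xs.Pairwise fun x y => t x < t y)
    (hmem : ∀ x, x ∈ xs ↔ a ≤ (x : ℕ) ∧ (x : ℕ) < b) :
    bstFringeCount k (bstOfList xs) =
      ((Finset.range (b + 1)).filter
        fun i => a ≤ i ∧ i + k ≤ b ∧ LocalBSTWindow k a b t i).card := by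
  induction hl : xs.length using Nat.strong_induction_on generalizing xs a b with
  | _ L ih =>
    cases xs with
    | nil =>
      rw [eq_comm, show bstOfList ([] : List (Fin n)) = .nil from rfl, bstFringeCount,
        Finset.card_eq_zero, Finset.filter_eq_empty_iff]
      rintro i hi ⟨h1, h2, -⟩
      have := (hmem ⟨i, by omega⟩).2 ⟨h1, by simp; omega⟩
      simp at this
    | cons c xs =>
      rw [List.pairwise_cons] at hsort
      have hc := (hmem c).1 (by simp)
      have hcxs : c ∉ xs := fun h => (hsort.1 c h).false
      have hnodup : (c :: xs).Nodup := by
        rw [List.nodup_cons]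
        exact ⟨hcxs, hsort.2.imp fun h e => by rw [e] at h; exact h.false⟩
      have hlen : (c :: xs).length = b - a := by
        rw [← List.toFinset_card_of_nodup hnodup, ← card_window hb]
        congr 1
        ext x
        rw [List.mem_toFinset, hmem, mem_window]
      have hfirst : ∀ x : Fin n, a ≤ (x : ℕ) → (x : ℕ) < b → x ≠ c → t c < t x := by
        intro x h1 h2 h3
        have := (hmem x).2 ⟨h1, h2⟩
        exact hsort.1 x ((List.mem_cons.1 this).resolve_left h3)
      have hmem' : ∀ x, x ∈ xs ↔ (a ≤ (x : ℕ) ∧ (x : ℕ) < b) ∧ x ≠ c := by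
        intro x
        rw [← hmem, List.mem_cons]
        constructor
        · exact fun h => ⟨Or.inr h, fun e => hcxs (e ▸ h)⟩
        · exact fun h => h.1.resolve_left h.2
      have hshort : ∀ q : Fin n → Bool, (xs.filter q).length < L := fun q => by
        rw [← hl, List.length_cons]
        exact Nat.lt_succ_of_le (List.length_filter_le _ _)
      have hleft := ih _ (hshort _) (xs.filter (· < c)) a c hc.1 (by omega)
        (hsort.2.filter _) (by
          intro x
          rw [List.mem_filter, hmem', decide_eq_true_eq, Fin.lt_def, Ne, Fin.ext_iff]
          omega) rfl
      have hright := ih _ (hshort _) (xs.filter (fun x => ¬ x < c)) (c + 1) b (by omega) hb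
        (hsort.2.filter _) (by
          intro x
          rw [List.mem_filter, hmem', decide_eq_true_eq, Fin.lt_def, Ne, Fin.ext_iff]
          omega) rfl
      have hroot : (BinaryTree.node c (bstOfList (xs.filter (· < c)))
          (bstOfList (xs.filter (fun x => ¬ x < c)))).numNodes = b - a := by
        rw [← bstOfList_cons, numNodes_bstOfList, hlen]
      rw [bstOfList_cons, bstFringeCount, hroot, hleft, hright]
      -- A window through the root that is not all of `[a, b)` has a boundary key in `[a, b)`, which
      -- would have to precede the earliest key.
      have hA : (if b - a = k then 1 else 0) = ((Finset.range (b + 1)).filter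
          fun i => (a ≤ i ∧ i + k ≤ b ∧ LocalBSTWindow k a b t i) ∧
            i ≤ (c : ℕ) ∧ (c : ℕ) < i + k).card := by
        split_ifs with h
        · rw [eq_comm, Finset.card_eq_one]
          refine ⟨a, ?_⟩
          ext i
          simp only [Finset.mem_filter, Finset.mem_range, Finset.mem_singleton]
          constructor
          · omega
          · rintro rfl
            refine ⟨by omega, ⟨le_rfl, by omega, ?_⟩, by omega, by omega⟩
            intro x y _ _ h; omega
        · rw [eq_comm, Finset.card_eq_zero, Finset.filter_eq_empty_iff]
          rintro i hi ⟨⟨h1, h2, h3⟩, h4, h5⟩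
          rcases h1.eq_or_lt with rfl | h1
          · have hlt : a + k < b := by omega
            have h6 := h3 c ⟨a + k, by omega⟩ h4 h5 (Or.inr ⟨rfl, hlt⟩)
            have h7 := hfirst ⟨a + k, by omega⟩ (by simp) hlt
              (by rw [Ne, Fin.ext_iff]; simp; omega)
            exact h6.not_gt h7
          · have h6 := h3 c ⟨i - 1, by omega⟩ h4 h5 (Or.inl ⟨by simp; omega, by simp; omega⟩)
            have h7 := hfirst ⟨i - 1, by omega⟩ (by simp; omega) (by simp; omega)
              (by rw [Ne, Fin.ext_iff]; simp; omega)
            exact h6.not_gt h7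
      -- Passing from `[a, c)` to `[a, b)` can only add the boundary key `c`, whose condition holds
      -- automatically because it comes first.
      have hB : ((Finset.range (c + 1)).filter
          fun i => a ≤ i ∧ i + k ≤ (c : ℕ) ∧ LocalBSTWindow k a c t i) =
        ((Finset.range (b + 1)).filter
          fun i => (a ≤ i ∧ i + k ≤ b ∧ LocalBSTWindow k a b t i) ∧ i + k ≤ (c : ℕ)) := by
        ext i
        simp only [Finset.mem_filter, Finset.mem_range]
        constructor
        · rintro ⟨h1, h2, h3, h4⟩
          refine ⟨by omega, ⟨h2, by omega, fun x y hx hx' hy => ?_⟩, h3⟩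
          by_cases hyc : (y : ℕ) < c
          · exact h4 x y hx hx' (by omega)
          · obtain rfl : y = c := Fin.ext (by omega)
            exact hfirst x (by omega) (by omega) (by rw [Ne, Fin.ext_iff]; omega)
        · rintro ⟨h1, ⟨h2, h3, h4⟩, h5⟩
          exact ⟨by omega, h2, h5, fun x y hx hx' hy => h4 x y hx hx' (by omega)⟩
      have hC : ((Finset.range (b + 1)).filter
          fun i => (c : ℕ) + 1 ≤ i ∧ i + k ≤ b ∧ LocalBSTWindow k (c + 1) b t i) =
        ((Finset.range (b + 1)).filter
          fun i => (a ≤ i ∧ i + k ≤ b ∧ LocalBSTWindow k a b t i) ∧ (c : ℕ) < i) := by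
        ext i
        simp only [Finset.mem_filter, Finset.mem_range]
        constructor
        · rintro ⟨h1, h2, h3, h4⟩
          refine ⟨by omega, ⟨by omega, by omega, fun x y hx hx' hy => ?_⟩, by omega⟩
          by_cases hyc : (c : ℕ) < y
          · exact h4 x y hx hx' (by omega)
          · obtain rfl : y = c := Fin.ext (by omega)
            exact hfirst x (by omega) (by omega) (by rw [Ne, Fin.ext_iff]; omega)
        · rintro ⟨h1, ⟨h2, h3, h4⟩, h5⟩
          exact ⟨by omega, by omega, h3, fun x y hx hx' hy => h4 x y hx hx' (by omega)⟩
      rw [hA, hB, hC, ← Finset.card_union_of_disjoint, ← Finset.card_union_of_disjoint]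
      · congr 1
        ext i
        simp only [Finset.mem_union, Finset.mem_filter, Finset.mem_range]
        constructor
        · tauto
        · intro h
          have : (i ≤ (c : ℕ) ∧ (c : ℕ) < i + k) ∨ i + k ≤ (c : ℕ) ∨ (c : ℕ) < i := by omega
          tauto
      · rw [Finset.disjoint_left]
        intro i
        simp only [Finset.mem_union, Finset.mem_filter, Finset.mem_range]
        omega
      · rw [Finset.disjoint_left]
        intro i
        simp only [Finset.mem_filter, Finset.mem_range]
        omega

/-- The number of fringe subtrees of a binary search tree as a number of windows. -/
theorem bstFringeCount_ofFn {n k : ℕ} (hk : 1 ≤ k) (hkn : k ≤ n) (s : Equiv.Perm (Fin n)) :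
    bstFringeCount k (bstOfList (List.ofFn fun i => s i)) =
      occurrences (Finset.range (n - k + 1)) (BSTWindow n k) s.symm := by
  classical
  rw [bstFringeCount_bstOfList k hk s.symm _ 0 n (Nat.zero_le _) le_rfl]
  · unfold occurrences
    congr 1
    ext i
    simp only [Finset.mem_filter, Finset.mem_range]
    have : i + k ≤ n → (LocalBSTWindow k 0 n s.symm i ↔ BSTWindow n k i s.symm) := by
      intro _
      unfold LocalBSTWindow BSTWindow
      refine forall_congr' fun x => forall_congr' fun y => ?_
      refine imp_congr_right fun h1 => imp_congr_right fun h2 => imp_congr_left ?_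
      have := y.isLt
      omega
    constructor
    · rintro ⟨h1, h2, h3, h4⟩
      exact ⟨by omega, (this h3).1 h4⟩
    · rintro ⟨h1, h2⟩
      exact ⟨by omega, by omega, by omega, (this (by omega)).2 h2⟩
  · rw [List.pairwise_ofFn]
    intro i j hij
    simpa using hij
  · intro x
    simp only [List.mem_ofFn, Nat.zero_le, x.isLt, and_self, iff_true]
    exact ⟨s.symm x, by simp⟩

end BinarySearchTrees

/-! ### Recursive trees as permutations -/

section RecursiveTrees

variable {N : ℕ}

/-- The recursive tree `c` in which the parent of a label is the last smaller label before it in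
the word `w`. -/
def Encodes (c : RecursiveTree (N + 1)) (w : Equiv.Perm (Fin (N + 1))) : Prop :=
  ∀ i : Fin N, ∃ q : Fin (N + 1), (w q : ℕ) = (c i : ℕ) ∧ q < w.symm i.succ ∧
    ∀ q', q < q' → q' < w.symm i.succ → i.succ < w q'

/-- The word starting with the label `0`, continued by a permutation of the other labels. -/
def extendPerm (t : Equiv.Perm (Fin N)) : Equiv.Perm (Fin (N + 1)) :=
  Equiv.Perm.decomposeFin.symm (0, t)

@[simp] lemma extendPerm_zero (t : Equiv.Perm (Fin N)) : extendPerm t 0 = 0 := by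
  simp [extendPerm]

@[simp] lemma extendPerm_succ (t : Equiv.Perm (Fin N)) (x : Fin N) :
    extendPerm t x.succ = (t x).succ := by
  simp [extendPerm]

lemma extendPerm_injective : Function.Injective (extendPerm (N := N)) := by
  intro t t' h
  ext x
  have := congrArg (fun e : Equiv.Perm (Fin (N + 1)) => e x.succ) h
  simp only [extendPerm_succ, Fin.succ_inj] at this
  rw [this]

/-- The label `0` in front guarantees an earlier smaller label; the parent is the last one. -/
lemma exists_encodes {w : Equiv.Perm (Fin (N + 1))} (hw : w 0 = 0) :
    ∃ c : RecursiveTree (N + 1), Encodes c w := by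
  have h : ∀ i : Fin N, ∃ q : Fin (N + 1), w q < i.succ ∧ q < w.symm i.succ ∧
      ∀ q', q < q' → q' < w.symm i.succ → i.succ < w q' := by
    intro i
    set S := Finset.univ.filter fun q : Fin (N + 1) => w q < i.succ ∧ q < w.symm i.succ with hS
    have hne : S.Nonempty := by
      refine ⟨0, ?_⟩
      simp only [hS, Finset.mem_filter, Finset.mem_univ, true_and, hw]
      refine ⟨Fin.succ_pos i, Fin.pos_of_ne_zero fun h => ?_⟩
      rw [Equiv.symm_apply_eq, hw] at h
      exact Fin.succ_ne_zero i h
    have hmem := S.max'_mem hne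
    simp only [hS, Finset.mem_filter, Finset.mem_univ, true_and] at hmem
    refine ⟨S.max' hne, hmem.1, hmem.2, fun q' h1 h2 => ?_⟩
    refine lt_of_le_of_ne (not_lt.1 fun h3 => ?_) fun h3 => ?_
    · have := S.le_max' q' (by simp only [hS, Finset.mem_filter, Finset.mem_univ, true_and]
                               exact ⟨h3, h2⟩)
      exact h1.not_ge this
    · rw [h3, Equiv.symm_apply_apply] at h2
      exact h2.false
  choose q h1 h2 h3 using h
  exact ⟨fun i => ⟨w (q i), by simpa [Fin.lt_def] using h1 i⟩, fun i => ⟨q i, rfl, h2 i, h3 i⟩⟩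

/-- Among the labels smaller than `i.succ`, this label stands immediately after its parent. The tree
thus dictates every insertion into the word. -/
lemma Encodes.pos_lt_iff {c : RecursiveTree (N + 1)} {w : Equiv.Perm (Fin (N + 1))}
    (h : Encodes c w) (i : Fin N) {z u : Fin (N + 1)} (hz : (z : ℕ) = c i) (hu : u < i.succ) :
    w.symm u < w.symm i.succ ↔ w.symm u ≤ w.symm z := by
  obtain ⟨q, h1, h2, h3⟩ := h i
  obtain rfl : z = w q := Fin.ext (by omega)
  rw [Equiv.symm_apply_apply]
  constructor
  · intro h4
    by_contra h5
    have := h3 _ (not_le.1 h5) h4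
    rw [Equiv.apply_symm_apply] at this
    exact this.not_gt hu
  · exact fun h4 => h4.trans_lt h2

/-- Strong induction on the larger label shows that `c` determines the relative order of any two
labels; a strictly monotone bijection of `Fin (N + 1)` is then the identity. -/
lemma Encodes.unique {c : RecursiveTree (N + 1)} {w w' : Equiv.Perm (Fin (N + 1))}
    (h : Encodes c w) (h' : Encodes c w') : w = w' := by
  have key : ∀ m : ℕ, ∀ v : Fin (N + 1), (v : ℕ) = m → ∀ u < v,
      (w.symm u < w.symm v ↔ w'.symm u < w'.symm v) := by
    intro m
    induction m using Nat.strong_induction_on with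
    | _ m ih =>
      intro v hv u huv
      obtain ⟨i, rfl⟩ : ∃ i : Fin N, i.succ = v :=
        ⟨v.pred fun h0 => by subst h0; exact (Fin.not_lt_zero u) huv, Fin.succ_pred _ _⟩
      have hci := (c i).isLt
      set z : Fin (N + 1) := ⟨c i, by omega⟩ with hz
      rw [h.pos_lt_iff i (z := z) rfl huv, h'.pos_lt_iff i (z := z) rfl huv]
      have hzv : (z : ℕ) < m := by rw [← hv, Fin.val_succ]; exact hci
      have hum : (u : ℕ) < m := by rw [← hv]; exact huv
      rcases lt_trichotomy u z with h1 | h1 | h1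
      · have := ih _ hzv z rfl u h1
        rw [le_iff_lt_or_eq, le_iff_lt_or_eq, this]
        simp [h1.ne]
      · simp [h1]
      · have := ih _ hum u rfl z h1
        rw [← not_lt, ← not_lt, this]
  have hlt : ∀ u v, w.symm u < w.symm v → w'.symm u < w'.symm v := by
    intro u v huv
    rcases lt_trichotomy u v with h1 | h1 | h1
    · exact (key _ v rfl u h1).1 huv
    · subst h1; exact absurd huv (lt_irrefl _)
    · have h2 := (key _ u rfl v h1).not
      exact lt_of_le_of_ne (not_lt.1 (h2.1 huv.not_gt)) fun h3 => h1.ne' (w'.symm.injective h3)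
  have hmono : StrictMono fun q => w'.symm (w q) := by
    intro p q hpq
    exact hlt _ _ (by simpa using hpq)
  have hid : (fun q => w'.symm (w q)) = id := by
    have := Subsingleton.elim (hmono.orderIsoOfSurjective _
      (w'.symm.surjective.comp w.surjective)) (OrderIso.refl (Fin (N + 1)))
    exact congrArg (fun e : Fin (N + 1) ≃o Fin (N + 1) => (e : Fin (N + 1) → Fin (N + 1))) this
  ext q
  have := congrFun hid q
  simp only [id, Equiv.symm_apply_eq] at this
  rw [this]

/-- The word is a depth-first traversal of the tree, so descendants follow `u` with no smaller label
in between. Conversely, the parent of a label in the block after `u` is again in the block or is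
`u`, which permits induction on the label. -/
lemma Encodes.mem_fringe_iff {c : RecursiveTree (N + 1)} {w : Equiv.Perm (Fin (N + 1))}
    (h : Encodes c w) (u v : Fin (N + 1)) :
    v ∈ c.fringe u ↔ w.symm u ≤ w.symm v ∧
      ∀ q, w.symm u < q → q ≤ w.symm v → u < w q := by
  constructor
  · intro huv
    induction huv with
    | refl => exact ⟨le_rfl, fun q h1 h2 => absurd h1 h2.not_gt⟩
    | @tail v x _ hpar ih =>
      obtain ⟨i, hx, hv⟩ := hpar
      obtain rfl : x = Fin.succ i := Fin.ext hx
      obtain ⟨q, h1, h2, h3⟩ := h i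
      obtain rfl : v = w q := Fin.ext (by omega)
      rw [Equiv.symm_apply_apply] at ih
      have hci := (c i).isLt
      have hux : u < Fin.succ i := by
        have huq : u ≤ w q := by
          rcases ih.1.eq_or_lt with h4 | h4
          · rw [← h4, Equiv.apply_symm_apply]
          · exact (ih.2 q h4 le_rfl).le
        refine huq.trans_lt ?_
        rw [Fin.lt_def, h1, Fin.val_succ]
        exact hci
      refine ⟨ih.1.trans h2.le, fun q' h4 h5 => ?_⟩
      rcases le_or_gt q' q with h6 | h6
      · exact ih.2 q' h4 h6
      · rcases h5.eq_or_lt with h7 | h7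
        · rw [h7, Equiv.apply_symm_apply]; exact hux
        · exact hux.trans (h3 q' h6 h7)
  · suffices hind : ∀ m : ℕ, ∀ v : Fin (N + 1), (v : ℕ) = m → (w.symm u ≤ w.symm v ∧
        ∀ q, w.symm u < q → q ≤ w.symm v → u < w q) → v ∈ c.fringe u from hind _ v rfl
    intro m
    induction m using Nat.strong_induction_on with
    | _ m ih =>
      rintro v hvm ⟨h1, h2⟩
      rcases h1.eq_or_lt with h3 | h3
      · obtain rfl := w.symm.injective h3
        exact Relation.ReflTransGen.refl
      · have huv := h2 _ h3 le_rfl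
        rw [Equiv.apply_symm_apply] at huv
        obtain ⟨i, rfl⟩ : ∃ i : Fin N, i.succ = v :=
          ⟨v.pred fun h0 => by subst h0; exact (Fin.not_lt_zero u) huv, Fin.succ_pred _ _⟩
        obtain ⟨q, h4, h5, h6⟩ := h i
        have hci := (c i).isLt
        have huq : w.symm u ≤ q := by
          by_contra h7
          have := h6 _ (not_le.1 h7) h3
          rw [Equiv.apply_symm_apply] at this
          exact this.not_gt huv
        have hq := ih (w q) (by rw [h4, ← hvm, Fin.val_succ]; exact hci) (w q) rfl
          (by
            rw [Equiv.symm_apply_apply]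
            exact ⟨huq, fun q' h7 h8 => h2 q' h7 (h8.trans h5.le)⟩)
        exact Relation.ReflTransGen.tail hq ⟨i, Fin.val_succ i, h4⟩

/-- The labels at the positions in `[p, p + m)` are a maximal block in which the first one is the
smallest. -/
def MaximalBlock (w : Equiv.Perm (Fin (N + 1))) (p : Fin (N + 1)) (m : ℕ) : Prop :=
  (p : ℕ) + m ≤ N + 1 ∧ (∀ q : Fin (N + 1), p < q → (q : ℕ) < p + m → w p < w q) ∧
    ∀ q : Fin (N + 1), (q : ℕ) = p + m → w q < w p

lemma exists_maximalBlock (w : Equiv.Perm (Fin (N + 1))) (p : Fin (N + 1)) :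
    ∃ m, 1 ≤ m ∧ MaximalBlock w p m := by
  classical
  have hex : ∃ m, 1 ≤ m ∧ ∀ q : Fin (N + 1), (q : ℕ) = p + m → w q < w p :=
    ⟨N + 1, by omega, fun q hq => by have := q.isLt; omega⟩
  have hspec := Nat.find_spec hex
  have hmin := fun m => Nat.find_min hex (m := m)
  set m := Nat.find hex
  refine ⟨m, hspec.1, ?_, fun q h1 h2 => ?_, hspec.2⟩
  · by_contra h
    refine hmin (N + 1 - p) (by omega) ⟨by omega, fun q hq => ?_⟩
    have := q.isLt; omega
  · rw [Fin.lt_def] at h1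
    by_contra h3
    refine hmin (q - p) (by omega) ⟨by omega, fun q' hq' => ?_⟩
    obtain rfl : q' = q := Fin.ext (by omega)
    exact lt_of_le_of_ne (not_lt.1 h3) fun h4 => by
      have := w.injective h4; subst this; omega

lemma Encodes.ncard_fringe_of_maximalBlock {c : RecursiveTree (N + 1)}
    {w : Equiv.Perm (Fin (N + 1))} (h : Encodes c w) {p : Fin (N + 1)} {m : ℕ} (hm : 1 ≤ m)
    (hb : MaximalBlock w p m) : (c.fringe (w p)).ncard = m := by
  have hset : c.fringe (w p) = w '' ↑(window (N + 1) (p : ℕ) (p + m)) := by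
    ext v
    rw [h.mem_fringe_iff, Equiv.symm_apply_apply]
    constructor
    · rintro ⟨h1, h2⟩
      refine ⟨w.symm v, ?_, by simp⟩
      rw [Finset.mem_coe, mem_window]
      refine ⟨h1, not_le.1 fun h3 => ?_⟩
      have hlt : (p : ℕ) + m < N + 1 := h3.trans_lt (w.symm v).isLt
      have h4 := h2 ⟨p + m, hlt⟩ (by rw [Fin.lt_def]; simp; omega) h3
      exact h4.not_gt (hb.2.2 _ rfl)
    · rintro ⟨q, hq, rfl⟩
      rw [Finset.mem_coe, mem_window] at hq
      rw [Equiv.symm_apply_apply]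
      refine ⟨hq.1, fun q' h1 h2 => hb.2.1 q' h1 ?_⟩
      rw [Fin.le_def] at h2
      omega
  rw [hset, Set.ncard_image_of_injective _ w.injective, Set.ncard_coe_finset,
    card_window hb.1]
  omega

lemma Encodes.ncard_fringe_iff {c : RecursiveTree (N + 1)} {w : Equiv.Perm (Fin (N + 1))}
    (h : Encodes c w) (p : Fin (N + 1)) {k : ℕ} (hk : 1 ≤ k) :
    (c.fringe (w p)).ncard = k ↔ MaximalBlock w p k := by
  refine ⟨fun hc => ?_, h.ncard_fringe_of_maximalBlock hk⟩
  obtain ⟨m, hm, hb⟩ := exists_maximalBlock w p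
  rw [h.ncard_fringe_of_maximalBlock hm hb] at hc
  exact hc ▸ hb

lemma maximalBlock_extendPerm_succ_iff (t : Equiv.Perm (Fin N)) (i : Fin N) (k : ℕ) :
    MaximalBlock (extendPerm t) i.succ k ↔ (i : ℕ) + k ≤ N ∧ RRTWindow N k i t := by
  unfold MaximalBlock RRTWindow
  refine and_congr (by rw [Fin.val_succ]; omega) ?_
  constructor
  · rintro ⟨h1, h2⟩ p hp
    obtain rfl : p = i := Fin.ext hp
    refine ⟨fun x hx hx' => ?_, fun y hy => ?_⟩
    · have := h1 x.succ (by rw [Fin.lt_def, Fin.val_succ, Fin.val_succ]; omega) (by simp only [Fin.val_succ]; omega)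
      simpa using this
    · have := h2 y.succ (by simp only [Fin.val_succ]; omega)
      simpa using this
  · intro h
    have h' := h i rfl
    refine ⟨fun q hq hq' => ?_, fun q hq => ?_⟩
    · obtain ⟨x, rfl⟩ : ∃ x : Fin N, x.succ = q :=
        ⟨q.pred fun h0 => by subst h0; exact (Fin.not_lt_zero _) hq, Fin.succ_pred _ _⟩
      have := h'.1 x (by rw [Fin.lt_def, Fin.val_succ, Fin.val_succ] at hq; omega) (by simp only [Fin.val_succ] at hq'; omega)
      simpa using this
    · obtain ⟨x, rfl⟩ : ∃ x : Fin N, x.succ = q :=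
        ⟨q.pred fun h0 => by subst h0; simp at hq; omega, Fin.succ_pred _ _⟩
      have := h'.2 x (by simp only [Fin.val_succ] at hq; omega)
      simpa using this

/-- The number of fringe subtrees of a recursive tree as a number of windows. -/
lemma Encodes.rrtFringeCount_eq {c : RecursiveTree (N + 1)} {t : Equiv.Perm (Fin N)}
    (h : Encodes c (extendPerm t)) {k : ℕ} (hk : 1 ≤ k) (hkN : k ≤ N) :
    rrtFringeCount k c = occurrences (Finset.range (N - k + 1)) (RRTWindow N k) t := by
  classical
  unfold rrtFringeCount occurrences
  rw [← Set.ncard_coe_finset, eq_comm]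
  have hN : ∀ i, i ∈ (↑((Finset.range (N - k + 1)).filter fun i => RRTWindow N k i t) : Set ℕ) →
      i < N := fun i hi => by
    simp only [Finset.coe_filter, Finset.mem_range, Set.mem_ofPred_eq] at hi
    omega
  refine Set.ncard_congr (fun i hi => extendPerm t (Fin.succ ⟨i, hN i hi⟩)) ?_ ?_ ?_
  · intro i hi
    have hiN := hN i hi
    simp only [Finset.coe_filter, Finset.mem_range, Set.mem_ofPred_eq] at hi
    rw [Set.mem_ofPred_eq, h.ncard_fringe_iff _ hk, maximalBlock_extendPerm_succ_iff]
    exact ⟨by simp only; omega, hi.2⟩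
  · intro i j hi hj hij
    simpa using hij
  · intro u hu
    obtain ⟨p, rfl⟩ := (extendPerm t).surjective u
    rw [Set.mem_ofPred_eq, h.ncard_fringe_iff _ hk] at hu
    -- The fringe subtree of the root is the whole tree, of size `N + 1 > k`; a block of length `k`
    -- would need a label below `0` after it.
    by_cases hp : p = 0
    · subst hp
      have := hu.2.2 ⟨k, by omega⟩ (by simp)
      rw [extendPerm_zero] at this
      exact absurd this (Fin.not_lt_zero _)
    · obtain ⟨i, rfl⟩ : ∃ i : Fin N, i.succ = p := ⟨p.pred hp, Fin.succ_pred _ _⟩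
      rw [maximalBlock_extendPerm_succ_iff] at hu
      refine ⟨i, ?_, rfl⟩
      simp only [Finset.coe_filter, Finset.mem_range, Set.mem_ofPred_eq]
      exact ⟨by omega, hu.2⟩

lemma card_recursiveTree (N : ℕ) : Fintype.card (RecursiveTree (N + 1)) = N.factorial := by
  rw [Fintype.card_pi]
  simp only [Fintype.card_fin]
  exact (Fin.prod_univ_eq_prod_range (fun i => i + 1) N).trans
    (Finset.prod_range_add_one_eq_factorial N)

/-- The tree determines the word, and both sides have `N!` elements. -/
theorem exists_equiv_recursiveTree (N : ℕ) :
    ∃ f : Equiv.Perm (Fin N) ≃ RecursiveTree (N + 1), ∀ t, Encodes (f t) (extendPerm t) := by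
  choose f hf using fun t : Equiv.Perm (Fin N) => exists_encodes (extendPerm_zero t)
  have hinj : Function.Injective f := fun t t' htt => by
    have h' := hf t'
    rw [← htt] at h'
    exact extendPerm_injective ((hf t).unique h')
  have hbij : Function.Bijective f := by
    rw [Fintype.bijective_iff_injective_and_card]
    refine ⟨hinj, ?_⟩
    rw [Fintype.card_perm, Fintype.card_fin, card_recursiveTree]
  exact ⟨Equiv.ofBijective f hbij, hf⟩

theorem expect_rrtFringeCount {k : ℕ} (hk : 1 ≤ k) (hkN : k ≤ N) (F : ℕ → ℝ) :
    𝔼 c : RecursiveTree (N + 1), F (rrtFringeCount k c) =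
      𝔼 t, F (occurrences (Finset.range (N - k + 1)) (RRTWindow N k) t) := by
  obtain ⟨f, hf⟩ := exists_equiv_recursiveTree N
  refine (Fintype.expect_equiv f _ _ fun t => ?_).symm
  rw [(hf t).rrtFringeCount_eq hk hkN]

end RecursiveTrees

open MeasureTheory ProbabilityTheory

/-! ### Total variation distance on the natural numbers -/

lemma measureReal_eq_tsum_indicator (μ : Measure ℕ) [IsFiniteMeasure μ] (A : Set ℕ) :
    μ.real A = ∑' l, A.indicator (fun l => μ.real {l}) l := by
  rw [measureReal_def, ← Measure.tsum_indicator_apply_singleton μ A .of_discrete,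
    ENNReal.tsum_toReal_eq fun l => by by_cases h : l ∈ A <;> simp [h]]
  refine tsum_congr fun l => ?_
  by_cases h : l ∈ A <;> simp [h, measureReal_def]

lemma summable_measureReal_singleton (μ : Measure ℕ) [IsFiniteMeasure μ] :
    Summable fun l => μ.real {l} := by
  refine ENNReal.summable_toReal ?_
  have := Measure.tsum_indicator_apply_singleton μ Set.univ .univ
  simp only [Set.indicator_univ] at this
  rw [this]
  exact measure_ne_top _ _

lemma dTV_nonneg {α : Type*} [MeasurableSpace α] (μ ν : Measure α) : 0 ≤ dTV μ ν :=
  Real.iSup_nonneg fun _ => abs_nonneg _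

lemma dTV_le {α : Type*} [MeasurableSpace α] {μ ν : Measure α} {r : ℝ}
    (h : ∀ A, MeasurableSet A → |μ.real A - ν.real A| ≤ r) : dTV μ ν ≤ r := by
  have : Nonempty {A : Set α // MeasurableSet A} := ⟨⟨∅, .empty⟩⟩
  exact ciSup_le fun A => h A.1 A.2

/-- The total variation distance of two distributions on `ℕ` is half of the `ℓ¹` distance of their
point probabilities. -/
theorem summable_and_dTV_eq_half_tsum (μ ν : Measure ℕ) [IsProbabilityMeasure μ]
    [IsProbabilityMeasure ν] :
    (Summable fun l => |μ.real {l} - ν.real {l}|) ∧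
      dTV μ ν = 1 / 2 * ∑' l, |μ.real {l} - ν.real {l}| := by
  have hμ := summable_measureReal_singleton μ
  have hν := summable_measureReal_singleton ν
  set d : ℕ → ℝ := fun l => μ.real {l} - ν.real {l} with hd
  have hds : Summable d := hμ.sub hν
  have habs : Summable fun l => |d l| := hds.abs
  have hA : ∀ A : Set ℕ, μ.real A - ν.real A = ∑' l, A.indicator d l := by
    intro A
    rw [measureReal_eq_tsum_indicator μ, measureReal_eq_tsum_indicator ν,
      ← (hμ.indicator A).tsum_sub (hν.indicator A)]
    refine tsum_congr fun l => ?_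
    by_cases h : l ∈ A <;> simp [h, hd]
  have hzero : ∑' l, d l = 0 := by
    have := hA Set.univ
    simp only [Set.indicator_univ] at this
    rw [← this]
    simp
  -- As `d` sums to zero, twice the difference is the sum of `d` with sign `+` on `A` and `-` off
  -- `A`; it is largest for `A = {d ≥ 0}`.
  have htwo : ∀ A : Set ℕ, 2 * (μ.real A - ν.real A) = ∑' l, (2 * A.indicator d l - d l) := by
    intro A
    rw [((hds.indicator A).mul_left 2).tsum_sub hds, tsum_mul_left, hzero, hA, sub_zero]
  have hbound : ∀ A : Set ℕ, |μ.real A - ν.real A| ≤ 1 / 2 * ∑' l, |d l| := by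
    intro A
    have hl : ∀ l, |2 * A.indicator d l - d l| = |d l| := by
      intro l
      by_cases h : l ∈ A
      · simp only [Set.indicator_of_mem h]; congr 1; ring
      · simp [Set.indicator_of_notMem h]
    have hle : |2 * (μ.real A - ν.real A)| ≤ ∑' l, |d l| := by
      rw [htwo A]
      refine (norm_tsum_le_tsum_norm (f := fun l => 2 * A.indicator d l - d l) ?_).trans_eq ?_
      · simpa only [Real.norm_eq_abs, hl] using habs
      · simp only [Real.norm_eq_abs, hl]
    rw [abs_mul, abs_two] at hle
    linarith
  refine ⟨habs, le_antisymm (dTV_le fun A _ => hbound A) ?_⟩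
  set P : Set ℕ := {l | 0 ≤ d l} with hP
  have hval : μ.real P - ν.real P = 1 / 2 * ∑' l, |d l| := by
    have h2 := htwo P
    have hl : ∀ l, 2 * P.indicator d l - d l = |d l| := by
      intro l
      by_cases h : l ∈ P
      · rw [Set.indicator_of_mem h, abs_of_nonneg (show 0 ≤ d l from h)]; ring
      · rw [Set.indicator_of_notMem h, abs_of_neg (not_le.1 (show ¬ 0 ≤ d l from h))]; ring
    simp only [hl] at h2
    linarith
  rw [← hval]
  refine (le_abs_self _).trans ?_
  exact le_ciSup (f := fun A : {A : Set ℕ // MeasurableSet A} => |μ.real A.1 - ν.real A.1|)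
    ⟨_, by rintro _ ⟨A, rfl⟩; exact hbound A.1⟩ ⟨P, .of_discrete⟩

lemma poissonMeasure_real_eq_tsum {r : ℝ} (hr : 0 ≤ r) (A : Set ℕ) :
    (poissonMeasure r.toNNReal).real A = ∑' l, A.indicator (poissonWeight r) l := by
  rw [measureReal_eq_tsum_indicator]
  simp only [poissonMeasure_real_singleton, Real.coe_toNNReal r hr]
  rfl

/-- One of `A` and `Aᶜ` misses `0`, and both measures give it mass at most `r`. This serves when the
mean itself is `O(1/k)`. -/
lemma abs_measureReal_sub_le {μ ν : Measure ℕ} [IsProbabilityMeasure μ] [IsProbabilityMeasure ν]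
    {r : ℝ} (hμ : μ.real {0}ᶜ ≤ r) (hν : ν.real {0}ᶜ ≤ r) (A : Set ℕ) :
    |μ.real A - ν.real A| ≤ r := by
  have key : ∀ B : Set ℕ, 0 ∉ B → |μ.real B - ν.real B| ≤ r := by
    intro B hB
    have hsub : B ⊆ {0}ᶜ := fun x hx h0 => hB (h0 ▸ hx)
    have h1 := (measureReal_mono hsub (μ := μ)).trans hμ
    have h2 := (measureReal_mono hsub (μ := ν)).trans hν
    have h3 : 0 ≤ μ.real B := measureReal_nonneg
    have h4 : 0 ≤ ν.real B := measureReal_nonneg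
    rw [abs_le]
    constructor <;> linarith
  by_cases h : 0 ∈ A
  · have := key Aᶜ (by simpa using h)
    rw [probReal_compl_eq_one_sub .of_discrete, probReal_compl_eq_one_sub .of_discrete] at this
    rwa [sub_sub_sub_cancel_left, abs_sub_comm] at this
  · exact key A h

lemma poissonMeasure_real_compl_zero_le {r : ℝ} (hr : 0 ≤ r) :
    (poissonMeasure r.toNNReal).real {0}ᶜ ≤ r := by
  rw [probReal_compl_eq_one_sub .of_discrete, poissonMeasure_real_singleton,
    Real.coe_toNNReal r hr]
  have := Real.add_one_le_exp (-r)
  simp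
  linarith

/-! ### Laws of functions on uniform finite probability spaces -/

/-- The law of a function of a uniformly random element of a finite type. -/
noncomputable def uniformLaw {Ω : Type*} [Fintype Ω] [Nonempty Ω] (X : Ω → ℕ) : Measure ℕ :=
  ((PMF.uniformOfFintype Ω).map X).toMeasure

section UniformLaw

variable {Ω : Type*} [Fintype Ω] [Nonempty Ω] (X : Ω → ℕ)

instance : IsProbabilityMeasure (uniformLaw X) := by
  unfold uniformLaw; infer_instance

lemma uniformLaw_real (A : Set ℕ) : (uniformLaw X).real A = 𝔼 ω, ind (X ω ∈ A) := by
  classical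
  rw [measureReal_def, uniformLaw, PMF.toMeasure_apply_eq_toOuterMeasure,
    PMF.toOuterMeasure_map_apply, PMF.toOuterMeasure_uniformOfFintype_apply,
    Fintype.expect_eq_sum_div_card]
  simp [ind, Fintype.card_subtype]

lemma uniformLaw_congr {Ω' : Type*} [Fintype Ω'] [Nonempty Ω'] {X : Ω → ℕ} {Y : Ω' → ℕ}
    (h : ∀ F : ℕ → ℝ, 𝔼 ω, F (X ω) = 𝔼 ω, F (Y ω)) : uniformLaw X = uniformLaw Y := by
  refine Measure.ext fun A _ => ?_
  have := (uniformLaw_real X A).trans ((h fun x => ind (x ∈ A)).trans (uniformLaw_real Y A).symm)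
  exact (measureReal_eq_measureReal_iff).1 this

lemma integral_uniformLaw : ∫ x, (x : ℝ) ∂(uniformLaw X) = 𝔼 ω, (X ω : ℝ) := by
  let : MeasurableSpace Ω := ⊤
  have : MeasurableSingletonClass Ω := ⟨fun _ => trivial⟩
  rw [uniformLaw, ← PMF.toMeasure_map X _ measurable_from_top,
    integral_map measurable_from_top.aemeasurable .of_discrete, PMF.integral_eq_sum,
    Fintype.expect_eq_sum_div_card, Finset.sum_div]
  simp [div_eq_inv_mul]

lemma uniformLaw_real_compl_zero_le : (uniformLaw X).real {0}ᶜ ≤ 𝔼 ω, (X ω : ℝ) := by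
  rw [uniformLaw_real]
  refine Finset.expect_le_expect fun ω _ => ?_
  by_cases h : X ω = 0
  · rw [ind_of_not (by simp [h])]; positivity
  · rw [ind_of (by simpa using h)]
    exact_mod_cast Nat.one_le_iff_ne_zero.2 h

end UniformLaw

lemma expect_occurrences {Ω ι : Type*} [Fintype Ω] (J : Finset ι) (I : ι → Ω → Prop) :
    𝔼 ω, (occurrences J I ω : ℝ) = ∑ i ∈ J, 𝔼 ω, ind (I i ω) := by
  simp only [occurrences_cast, Finset.expect_sum_comm]

/-! ### The laws of the numbers of fringe subtrees -/

theorem bstLaw_eq_uniformLaw {n k : ℕ} (hk : 1 ≤ k) (hkn : k < n) :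
    bstLaw n k = uniformLaw (occurrences (Finset.range (n - k + 1)) (BSTWindow n k)) := by
  have h1 : bstLaw n k = uniformLaw fun s : Equiv.Perm (Fin n) =>
      bstFringeCount k (bstOfList (List.ofFn fun i => s i)) := by
    unfold bstLaw uniformLaw randomBST
    rw [PMF.map_comp]
    rfl
  rw [h1]
  refine uniformLaw_congr fun F => ?_
  -- Inversion turns the key drawn at each time into the time at which each key is drawn, and
  -- preserves uniformity.
  refine Fintype.expect_equiv (Equiv.inv (Equiv.Perm (Fin n))) _ _ fun s => ?_
  rw [bstFringeCount_ofFn hk hkn.le]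
  rfl

lemma randomRecursiveTree_eq (n : ℕ) :
    randomRecursiveTree n = (PMF.uniformOfFintype (RecursiveTree n)).toMeasure := by
  refine Measure.ext_of_singleton fun c => ?_
  rw [randomRecursiveTree, Measure.pi_singleton]
  simp only [PMF.toMeasure_apply_singleton _ _ (MeasurableSet.singleton _),
    PMF.uniformOfFintype_apply, Fintype.card_pi, Fintype.card_fin]
  rw [Nat.cast_prod, ENNReal.prod_inv_distrib]
  intro i _ j _ _
  right
  exact ENNReal.natCast_ne_top _

theorem rrtLaw_eq_uniformLaw {N k : ℕ} (hk : 1 ≤ k) (hkN : k ≤ N) :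
    rrtLaw (N + 1) k = uniformLaw (occurrences (Finset.range (N - k + 1)) (RRTWindow N k)) := by
  have h1 : rrtLaw (N + 1) k = uniformLaw fun c : RecursiveTree (N + 1) => rrtFringeCount k c := by
    unfold rrtLaw uniformLaw
    rw [randomRecursiveTree_eq]
    exact PMF.toMeasure_map _ _ (measurable_of_finite _)
  rw [h1]
  exact uniformLaw_congr fun F => expect_rrtFringeCount hk hkN F

theorem bstMean_eq {n k : ℕ} (hk : 1 ≤ k) (hkn : k < n) :
    bstMean n k = 2 * ((n : ℝ) + 1) / (((k : ℝ) + 1) * ((k : ℝ) + 2)) := by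
  rw [bstMean, bstLaw_eq_uniformLaw hk hkn, integral_uniformLaw, expect_occurrences,
    ← sum_bstWindowProb hkn]
  exact Finset.sum_congr rfl fun i hi =>
    expect_bstWindow hkn (Nat.lt_succ_iff.1 (Finset.mem_range.1 hi))

theorem rrtMean_eq {n k : ℕ} (hk : 1 ≤ k) (hkn : k < n) :
    rrtMean n k = (n : ℝ) / ((k : ℝ) * ((k : ℝ) + 1)) := by
  obtain ⟨N, rfl⟩ : ∃ N, n = N + 1 := ⟨n - 1, by omega⟩
  have hkN : k ≤ N := by omega
  rw [rrtMean, rrtLaw_eq_uniformLaw hk hkN, integral_uniformLaw, expect_occurrences,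
    Nat.cast_succ, ← sum_rrtWindowProb hk hkN]
  exact Finset.sum_congr rfl fun i hi =>
    expect_rrtWindow hk hkN (Nat.lt_succ_iff.1 (Finset.mem_range.1 hi))

theorem dTV_bstLaw_le {n k : ℕ} (hk : 1 ≤ k) (hkn : k < n) :
    dTV (bstLaw n k) (poissonMeasure (bstMean n k).toNNReal) ≤ 84 / k := by
  have hk0 : (0 : ℝ) < k := by exact_mod_cast hk
  have hmean := bstMean_eq hk hkn
  have hnn : 0 ≤ bstMean n k := by rw [hmean]; positivity
  refine dTV_le fun A _ => ?_
  rcases Nat.lt_or_ge (2 * k + 1) n with h | h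
  · rw [poissonMeasure_real_eq_tsum hnn, hmean, bstLaw_eq_uniformLaw hk hkn, uniformLaw_real]
    exact abs_expect_bstWindow_sub_poisson_le hk h A
  -- For `n ≤ 2 * k + 1` the mean is at most `4 / (k + 2)`, so by Markov's inequality both laws are
  -- nearly concentrated at `0`.
  · have hμ : (bstLaw n k).real {0}ᶜ ≤ bstMean n k := by
      rw [bstMean, bstLaw_eq_uniformLaw hk hkn, integral_uniformLaw]
      exact uniformLaw_real_compl_zero_le _
    have : IsProbabilityMeasure (bstLaw n k) := by
      rw [bstLaw_eq_uniformLaw hk hkn]; infer_instance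
    refine (abs_measureReal_sub_le hμ (poissonMeasure_real_compl_zero_le hnn) A).trans ?_
    rw [hmean, div_le_div_iff₀ (by positivity) hk0]
    have hn : (n : ℝ) ≤ 2 * k + 1 := by exact_mod_cast h
    nlinarith

theorem dTV_rrtLaw_le {n k : ℕ} (hk : 1 ≤ k) (hkn : k < n) :
    dTV (rrtLaw n k) (poissonMeasure (rrtMean n k).toNNReal) ≤ 84 / k := by
  have hmean := rrtMean_eq hk hkn
  have hnn : 0 ≤ rrtMean n k := by rw [hmean]; positivity
  obtain ⟨N, rfl⟩ : ∃ N, n = N + 1 := ⟨n - 1, by omega⟩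
  have hkN : k ≤ N := by omega
  refine dTV_le fun A _ => ?_
  rw [poissonMeasure_real_eq_tsum hnn, hmean, rrtLaw_eq_uniformLaw hk hkN, uniformLaw_real,
    Nat.cast_succ]
  exact abs_expect_rrtWindow_sub_poisson_le hk hkN A

lemma summable_and_dTV_poisson (μ : Measure ℕ) [IsProbabilityMeasure μ] {r : ℝ} (hr : 0 ≤ r) :
    (Summable fun l : ℕ => |μ.real {l} - Real.exp (-r) * r ^ l / (Nat.factorial l : ℝ)|) ∧
      dTV μ (poissonMeasure r.toNNReal) = (1 / 2 : ℝ) *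
        ∑' l : ℕ, |μ.real {l} - Real.exp (-r) * r ^ l / (Nat.factorial l : ℝ)| := by
  have := summable_and_dTV_eq_half_tsum μ (poissonMeasure r.toNNReal)
  simpa only [poissonMeasure_real_singleton, Real.coe_toNNReal r hr] using this

end FringeTrees

/-! ### Means, total variation formula, rate and limit -/

theorem theorem1 :
    -- the means
    (∀ n k : ℕ, 1 ≤ k → k < n →
      FringeTrees.bstMean n k = 2 * ((n : ℝ) + 1) / (((k : ℝ) + 1) * ((k : ℝ) + 2)) ∧
      FringeTrees.rrtMean n k = (n : ℝ) / ((k : ℝ) * ((k : ℝ) + 1))) ∧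
    -- the total variation distance as half an absolutely convergent sum
    (∀ n k : ℕ, 1 ≤ k → k < n →
      (Summable (fun l : ℕ => |(FringeTrees.bstLaw n k).real {l} -
          Real.exp (-FringeTrees.bstMean n k) * FringeTrees.bstMean n k ^ l /
            (Nat.factorial l : ℝ)|) ∧
        FringeTrees.dTV (FringeTrees.bstLaw n k)
            (ProbabilityTheory.poissonMeasure (FringeTrees.bstMean n k).toNNReal) =
          (1 / 2 : ℝ) * ∑' l : ℕ, |(FringeTrees.bstLaw n k).real {l} -
            Real.exp (-FringeTrees.bstMean n k) * FringeTrees.bstMean n k ^ l /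
              (Nat.factorial l : ℝ)|) ∧
      (Summable (fun l : ℕ => |(FringeTrees.rrtLaw n k).real {l} -
          Real.exp (-FringeTrees.rrtMean n k) * FringeTrees.rrtMean n k ^ l /
            (Nat.factorial l : ℝ)|) ∧
        FringeTrees.dTV (FringeTrees.rrtLaw n k)
            (ProbabilityTheory.poissonMeasure (FringeTrees.rrtMean n k).toNNReal) =
          (1 / 2 : ℝ) * ∑' l : ℕ, |(FringeTrees.rrtLaw n k).real {l} -
            Real.exp (-FringeTrees.rrtMean n k) * FringeTrees.rrtMean n k ^ l /
              (Nat.factorial l : ℝ)|)) ∧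
    -- the rate `O(1/k)`, uniformly in `n` and `k`
    (∃ C : ℝ, ∀ n k : ℕ, 1 ≤ k → k < n →
      FringeTrees.dTV (FringeTrees.bstLaw n k)
          (ProbabilityTheory.poissonMeasure (FringeTrees.bstMean n k).toNNReal) ≤ C / (k : ℝ) ∧
      FringeTrees.dTV (FringeTrees.rrtLaw n k)
          (ProbabilityTheory.poissonMeasure (FringeTrees.rrtMean n k).toNNReal) ≤ C / (k : ℝ)) ∧
    -- convergence to zero when `k < n` and `k → ∞`, hence `n → ∞`
    (∀ N K : ℕ → ℕ, (∀ᶠ j in Filter.atTop, K j < N j) →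
      Filter.Tendsto K Filter.atTop Filter.atTop →
      Filter.Tendsto (fun j => FringeTrees.dTV (FringeTrees.bstLaw (N j) (K j))
          (ProbabilityTheory.poissonMeasure (FringeTrees.bstMean (N j) (K j)).toNNReal))
        Filter.atTop (nhds 0) ∧
      Filter.Tendsto (fun j => FringeTrees.dTV (FringeTrees.rrtLaw (N j) (K j))
          (ProbabilityTheory.poissonMeasure (FringeTrees.rrtMean (N j) (K j)).toNNReal))
        Filter.atTop (nhds 0)) := by
  have hbst : ∀ n k : ℕ, 1 ≤ k → k < n →
      FringeTrees.dTV (FringeTrees.bstLaw n k)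
        (ProbabilityTheory.poissonMeasure (FringeTrees.bstMean n k).toNNReal) ≤ 84 / (k : ℝ) :=
    fun n k hk hkn => FringeTrees.dTV_bstLaw_le hk hkn
  have hrrt : ∀ n k : ℕ, 1 ≤ k → k < n →
      FringeTrees.dTV (FringeTrees.rrtLaw n k)
        (ProbabilityTheory.poissonMeasure (FringeTrees.rrtMean n k).toNNReal) ≤ 84 / (k : ℝ) :=
    fun n k hk hkn => FringeTrees.dTV_rrtLaw_le hk hkn
  refine ⟨fun n k hk hkn => ⟨FringeTrees.bstMean_eq hk hkn, FringeTrees.rrtMean_eq hk hkn⟩,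
    fun n k hk hkn => ⟨?_, ?_⟩, ⟨84, fun n k hk hkn => ⟨hbst n k hk hkn, hrrt n k hk hkn⟩⟩,
    fun N K hKN hK => ?_⟩
  · have : MeasureTheory.IsProbabilityMeasure (FringeTrees.bstLaw n k) := by
      rw [FringeTrees.bstLaw_eq_uniformLaw hk hkn]; infer_instance
    refine FringeTrees.summable_and_dTV_poisson _ ?_
    rw [FringeTrees.bstMean_eq hk hkn]; positivity
  · have : MeasureTheory.IsProbabilityMeasure (FringeTrees.rrtLaw n k) := by
      obtain ⟨N, rfl⟩ : ∃ N, n = N + 1 := ⟨n - 1, by omega⟩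
      rw [FringeTrees.rrtLaw_eq_uniformLaw hk (Nat.lt_succ_iff.1 hkn)]; infer_instance
    refine FringeTrees.summable_and_dTV_poisson _ ?_
    rw [FringeTrees.rrtMean_eq hk hkn]; positivity
  · have hlim : Filter.Tendsto (fun j => (84 : ℝ) / (K j : ℝ)) Filter.atTop (nhds 0) :=
      (tendsto_natCast_atTop_atTop.comp hK).const_div_atTop 84
    have hev : ∀ᶠ j in Filter.atTop, 1 ≤ K j ∧ K j < N j :=
      (hK.eventually_ge_atTop 1).and hKN
    exact ⟨squeeze_zero' (Filter.Eventually.of_forall fun j => FringeTrees.dTV_nonneg _ _)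
        (hev.mono fun j hj => hbst _ _ hj.1 hj.2) hlim,
      squeeze_zero' (Filter.Eventually.of_forall fun j => FringeTrees.dTV_nonneg _ _)
        (hev.mono fun j hj => hrrt _ _ hj.1 hj.2) hlim⟩
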